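/- Let $A\in\mathbb R^{n\times n}$, $0\ne \mathbf v\in\mathbb R^n$, $\beta=\|\mathbf v\|_2$, $k\ge 1$, and suppose that $k$ steps of the Arnoldi process for $A$ started with $\mathbf v_1=\mathbf v/\beta$ do not break down: for $j=1,\dots,k$, with $h_{i,j}=(A\mathbf v_j,\mathbf v_i)$ for $i\le j$ and $\mathbf w_j=A\mathbf v_j-\sum_{i\le j}h_{i,j}\mathbf v_i$, one has $h_{j+1,j}=\|\mathbf w_j\|_2\neq 0$, and $\mathbf v_{j+1}=\mathbf w_j/h_{j+1,j}$. Let $V_k=[\mathbf v_1,\dots,\mathbf v_k]$, and let $H_k$ be the $k\times k$ upper Hessenberg matrix with entries $h_{i,j}$ for $i\le j+1$ and $0$ for $i>j+1$. Let $\gamma\in\mathbb R$ be such that $I+\gamma H_k$ is nonsingular, and let $$T_k=H_k+\gamma h_{k+1,k}^2(I+\gamma H_k)^{-\mathrm H}\mathbf e_k\mathbf e_k^{\mathrm H}.$$ Let $\varphi_0(z)=e^z$ and $\varphi_\ell(z)=\frac1{(\ell-1)!}\int_0^1e^{(1-\theta)z}\theta^{\ell-1}\,d\theta$ for $\ell\ge1$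 (also for matrix arguments). For an integer $\ell\ge0$ and $t>0$, the harmonic Arnoldi approximation to $\varphi_\ell(-tA)\mathbf v$, its error and its residual are $$\widehat{\mathbf y}_{\ell,k}(t)=V_k\varphi_\ell(-tT_k)\beta\mathbf e_1,\qquad \widehat{\mathbf e}_{\ell,k}(t)=\varphi_\ell(-tA)\mathbf v-\widehat{\mathbf y}_{\ell,k}(t),$$ $$\widehat{\mathbf r}_{0,k}(t)=-A\widehat{\mathbf y}_{0,k}(t)-\widehat{\mathbf y}_{0,k}'(t),\qquad \widehat{\mathbf r}_{\ell,k}(t)=-A\widehat{\mathbf y}_{\ell,k}(t)-\frac{\ell}{t}\widehat{\mathbf y}_{\ell,k}(t)+\frac{1}{t(\ell-1)!}\mathbf v-\widehat{\mathbf y}_{\ell,k}'(t)\quad(\ell\ge1).$$ For a complex square matrix $M$ let $W(M)=\{(M\mathbf x,\mathbf x)/(\mathbf x,\mathbf x):\mathbf x\ne\mathbf 0 \text{ complex}\}$ be its numerical range, and for $a\ge0$ and $0\le\vartheta\le\pi/2$ let $\Sigma_{\vartheta,a}=\{z\in\mathbb C:|\arg(z-a)|\le\vartheta\}$ (with the convention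 $\arg 0=0$). Assume $W(A)\subset\Sigma_{\vartheta,a}$ and $W(T_k)\subset\Sigma_{\vartheta,a}$. Let $\varepsilon>0$, let $\widehat\mu_j=\widehat a_j+\mathbf i\widehat b_j$ $(j=1,\dots,k)$ be the eigenvalues of $T_k$ with algebraic multiplicity, ordered so that $\widehat\mu_1,\dots,\widehat\mu_{k_2}$ are the real ones and $\widehat\mu_{k_2+1},\dots,\widehat\mu_k$ the non-real ones, and put $$\widehat r_j=\big((\varepsilon+\widehat a_j)^2+\widehat b_j^2\big)^{1/2},\quad \widehat\omega_k(\varepsilon)=\prod_{j=1}^k\big(\widehat r_j(\varepsilon+\widehat a_j)\big)^{1/2},\quad \widehat\varsigma_k(\rho)=\prod_{j=1}^{k_2}\Big(1+\frac{\rho^2}{\widehat r_j^2}\Big)^{1/2}\prod_{j=k_2+1}^{k}\Big(1+\frac{\rho^2}{\widehat r_j^2}\Big)^{1/4}.$$ Suppose that $k+k_2+2\ell\ge4$ and $\mathbf e_k^{\mathrm H}\varphi_\ell(-tT_k)\mathbf e_1\ne0$. Then the integral below converges, and $$\|\widehat{\mathbf e}_{\ell,k}(t)\|_2\le \widehat c_{\ell,k}\int_0^\infty\frac{(1+\rho^2/\varepsilon^2)^{-\ell/2}}{\widehat\varsigma_k(\rho)}\,d\rho\;\|\widehat{\mathbf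 r}_{\ell,k}(t)\|_2,\qquad \widehat c_{\ell,k}=\frac{\exp(t\varepsilon)}{\pi(t\varepsilon)^\ell\,\widehat\omega_k(\varepsilon)(\varepsilon+a)}\cdot\frac{\prod_{j=1}^{k-1}h_{j+1,j}}{|\mathbf e_k^{\mathrm H}\varphi_\ell(-tT_k)\mathbf e_1|}.$$ -/

import Mathlib

open scoped Matrix Nat

namespace HarmonicArnoldi

noncomputable section

/-! ### Numerical range, sector, and the functions `φ_ℓ` of a matrix -/

/-- The numerical range `{(M x, x) / (x, x) : 0 ≠ x ∈ ℂ^ι}` of a complex matrix. -/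
def numRange {ι : Type*} [Fintype ι] [DecidableEq ι] (M : Matrix ι ι ℂ) : Set ℂ :=
  {z | ∃ x : EuclideanSpace ℂ ι, x ≠ 0 ∧ z = inner ℂ x (Matrix.toEuclideanLin M x) / inner ℂ x x}

/-- The sector `Σ_{ϑ,a} = {z ∈ ℂ : |arg (z - a)| ≤ ϑ}` with apex `a`. -/
def sector (ϑ a : ℝ) : Set ℂ := {z | |Complex.arg (z - (a : ℂ))| ≤ ϑ}

/-- A real matrix regarded as a complex one. -/
def toC {ι : Type*} (M : Matrix ι ι ℝ) : Matrix ι ι ℂ := M.map (fun x => (x : ℂ))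

/-- `φ_ℓ` of a real square matrix: `φ_0(M) = exp M` and, entrywise,
`φ_ℓ(M) = 1 / (ℓ - 1)! ∫_0^1 exp ((1 - θ) M) θ^(ℓ - 1) dθ` for `ℓ ≥ 1`. -/
def phi {ι : Type*} [Fintype ι] [DecidableEq ι] : ℕ → Matrix ι ι ℝ → Matrix ι ι ℝ
  | 0, M => NormedSpace.exp M
  | ℓ + 1, M => Matrix.of fun i j =>
      (1 / (ℓ ! : ℝ)) * ∫ θ in (0 : ℝ)..1, NormedSpace.exp ((1 - θ) • M) i j * θ ^ ℓ

/-! ### The Arnoldi process (all indices start at `0`) -/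

variable {n : ℕ}

/-- The Arnoldi vectors: `arnoldiVec A v j` is `v_{j+1}`. It starts with `v / ‖v‖`, and the next
vector is `A v_{j+1}`, orthogonalized against all previous vectors and normalized. -/
def arnoldiVec (A : Matrix (Fin n) (Fin n) ℝ) (v : EuclideanSpace ℝ (Fin n)) :
    ℕ → EuclideanSpace ℝ (Fin n)
  | 0 => ‖v‖⁻¹ • v
  | j + 1 =>
      let w := Matrix.toEuclideanLin A (arnoldiVec A v j) -
        ∑ i : Fin (j + 1),
          (inner ℝ (arnoldiVec A v i) (Matrix.toEuclideanLin A (arnoldiVec A v j)) : ℝ) •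
            arnoldiVec A v i
      ‖w‖⁻¹ • w
  termination_by j => j
  decreasing_by all_goals omega

/-- The vector `A v_{j+1}` orthogonalized against `v_1, …, v_{j+1}`, before normalization. -/
def arnoldiRem (A : Matrix (Fin n) (Fin n) ℝ) (v : EuclideanSpace ℝ (Fin n)) (j : ℕ) :
    EuclideanSpace ℝ (Fin n) :=
  Matrix.toEuclideanLin A (arnoldiVec A v j) -
    ∑ i : Fin (j + 1),
      (inner ℝ (arnoldiVec A v i) (Matrix.toEuclideanLin A (arnoldiVec A v j)) : ℝ) •
        arnoldiVec A v i

/-- The subdiagonal coefficient `h_{j+2,j+1}` (in `1`-based indexing) of the Arnoldi process. -/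
def arnoldiSub (A : Matrix (Fin n) (Fin n) ℝ) (v : EuclideanSpace ℝ (Fin n)) (j : ℕ) : ℝ :=
  ‖arnoldiRem A v j‖

/-- The `k × k` upper Hessenberg matrix `H_k` of the Arnoldi process. -/
def arnoldiH (A : Matrix (Fin n) (Fin n) ℝ) (v : EuclideanSpace ℝ (Fin n)) (k : ℕ) :
    Matrix (Fin k) (Fin k) ℝ :=
  Matrix.of fun i j =>
    if (i : ℕ) ≤ j then
      inner ℝ (arnoldiVec A v i) (Matrix.toEuclideanLin A (arnoldiVec A v j))
    else if (i : ℕ) = j + 1 then arnoldiSub A v j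
    else 0

/-- The first standard basis vector `e_1` of `ℝ^k`. -/
def eFirst (k : ℕ) : Fin k → ℝ := fun i => if (i : ℕ) = 0 then 1 else 0

/-- The last standard basis vector `e_k` of `ℝ^k`. -/
def eLast (k : ℕ) : Fin k → ℝ := fun i => if (i : ℕ) + 1 = k then 1 else 0

/-! ### The harmonic Arnoldi method -/

/-- `T_k = H_k + γ h_{k+1,k}^2 (I + γ H_k)^{-H} e_k e_k^H`. See `arnoldiT_eq` for
`T_k = (Q_k⁻¹ - I) / γ`. -/
def arnoldiT (A : Matrix (Fin n) (Fin n) ℝ) (v : EuclideanSpace ℝ (Fin n)) (γ : ℝ) (k : ℕ) :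
    Matrix (Fin k) (Fin k) ℝ :=
  arnoldiH A v k + (γ * arnoldiSub A v (k - 1) ^ 2) •
    (((1 + γ • arnoldiH A v k)ᴴ)⁻¹ * Matrix.vecMulVec (eLast k) (eLast k))

/-- `Q_k = M_k⁻¹ (I + γ H_k)^H` with
`M_k = (I + γ H_k)^H (I + γ H_k) + γ^2 h_{k+1,k}^2 e_k e_k^H`. -/
def arnoldiQ (A : Matrix (Fin n) (Fin n) ℝ) (v : EuclideanSpace ℝ (Fin n)) (γ : ℝ) (k : ℕ) :
    Matrix (Fin k) (Fin k) ℝ :=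
  ((1 + γ • arnoldiH A v k)ᴴ * (1 + γ • arnoldiH A v k) +
    (γ ^ 2 * arnoldiSub A v (k - 1) ^ 2) • Matrix.vecMulVec (eLast k) (eLast k))⁻¹ *
    (1 + γ • arnoldiH A v k)ᴴ

/-- `ŷ_{ℓ,k}(t) = V_k φ_ℓ(-t T_k) β e_1` with `β = ‖v‖`. -/
def approx (A : Matrix (Fin n) (Fin n) ℝ) (v : EuclideanSpace ℝ (Fin n)) (γ : ℝ) (ℓ k : ℕ)
    (t : ℝ) : EuclideanSpace ℝ (Fin n) :=
  ∑ j : Fin k, (phi ℓ (-t • arnoldiT A v γ k) *ᵥ (‖v‖ • eFirst k)) j • arnoldiVec A v j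

/-- The error `ê_{ℓ,k}(t) = φ_ℓ(-t A) v - ŷ_{ℓ,k}(t)`. -/
def err (A : Matrix (Fin n) (Fin n) ℝ) (v : EuclideanSpace ℝ (Fin n)) (γ : ℝ) (ℓ k : ℕ)
    (t : ℝ) : EuclideanSpace ℝ (Fin n) :=
  Matrix.toEuclideanLin (phi ℓ (-t • A)) v - approx A v γ ℓ k t

/-- The residual `r̂_{ℓ,k}(t)`: it is `-A ŷ - ŷ'` for `ℓ = 0` and
`-A ŷ - (ℓ / t) ŷ + 1 / (t (ℓ - 1)!) v - ŷ'` for `ℓ ≥ 1`, where `ŷ = ŷ_{ℓ,k}`. -/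
def resid (A : Matrix (Fin n) (Fin n) ℝ) (v : EuclideanSpace ℝ (Fin n)) (γ : ℝ) :
    ℕ → ℕ → ℝ → EuclideanSpace ℝ (Fin n)
  | 0, k, t => -Matrix.toEuclideanLin A (approx A v γ 0 k t) - deriv (approx A v γ 0 k) t
  | ℓ + 1, k, t =>
      -Matrix.toEuclideanLin A (approx A v γ (ℓ + 1) k t)
        - (((ℓ + 1 : ℕ) : ℝ) / t) • approx A v γ (ℓ + 1) k t
        + (1 / (t * (ℓ ! : ℝ))) • v
        - deriv (approx A v γ (ℓ + 1) k) t

/-- The scalar `e_k^H φ_ℓ(-t T_k) e_1`. -/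
def corner (A : Matrix (Fin n) (Fin n) ℝ) (v : EuclideanSpace ℝ (Fin n)) (γ : ℝ) (ℓ k : ℕ)
    (t : ℝ) : ℝ :=
  eLast k ⬝ᵥ (phi ℓ (-t • arnoldiT A v γ k) *ᵥ eFirst k)

/-! ### Quantities built from the eigenvalues -/

/-- The complex eigenvalues of a real `k × k` matrix, with algebraic multiplicity. -/
def eigs {k : ℕ} (T : Matrix (Fin k) (Fin k) ℝ) : Multiset ℂ := (toC T).charpoly.roots

/-- The real eigenvalues, with algebraic multiplicity. -/
def realEigs {k : ℕ} (T : Matrix (Fin k) (Fin k) ℝ) : Multiset ℂ :=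
  (eigs T).filter fun μ => μ.im = 0

/-- The non-real eigenvalues, with algebraic multiplicity. -/
def nonrealEigs {k : ℕ} (T : Matrix (Fin k) (Fin k) ℝ) : Multiset ℂ :=
  (eigs T).filter fun μ => ¬ μ.im = 0

/-- `r(μ) = ((ε + Re μ)^2 + (Im μ)^2)^{1/2}`. -/
def rad (ε : ℝ) (μ : ℂ) : ℝ := ((ε + μ.re) ^ 2 + μ.im ^ 2) ^ ((1 : ℝ) / 2)

/-- `ω(ε) = ∏_j (r_j (ε + a_j))^{1/2}`. -/
def omega {k : ℕ} (T : Matrix (Fin k) (Fin k) ℝ) (ε : ℝ) : ℝ :=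
  ((eigs T).map fun μ => (rad ε μ * (ε + μ.re)) ^ ((1 : ℝ) / 2)).prod

/-- `ς(ρ) = ∏_{μ_j real} (1 + ρ^2 / r_j^2)^{1/2} ∏_{μ_j non-real} (1 + ρ^2 / r_j^2)^{1/4}`. -/
def varsig {k : ℕ} (T : Matrix (Fin k) (Fin k) ℝ) (ε ρ : ℝ) : ℝ :=
  ((realEigs T).map fun μ => (1 + ρ ^ 2 / rad ε μ ^ 2) ^ ((1 : ℝ) / 2)).prod *
    ((nonrealEigs T).map fun μ => (1 + ρ ^ 2 / rad ε μ ^ 2) ^ ((1 : ℝ) / 4)).prod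

/-- The constant `ĉ_{ℓ,k}`, that is, `exp (t ε) / (π (t ε)^ℓ ω(ε) (ε + a))` times
`∏_{j=1}^{k-1} h_{j+1,j} / |e_k^H φ_ℓ(-t T_k) e_1|`. -/
def cHat (A : Matrix (Fin n) (Fin n) ℝ) (v : EuclideanSpace ℝ (Fin n)) (γ : ℝ) (ℓ k : ℕ)
    (t ε a : ℝ) : ℝ :=
  Real.exp (t * ε) / (Real.pi * (t * ε) ^ ℓ * omega (arnoldiT A v γ k) ε * (ε + a)) *
    ((∏ j ∈ Finset.range (k - 1), arnoldiSub A v j) / |corner A v γ ℓ k t|)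

/-- The integrand `(1 + ρ^2 / ε^2)^{-ℓ/2} / ς(ρ)`. -/
def integrand {k : ℕ} (T : Matrix (Fin k) (Fin k) ℝ) (ℓ : ℕ) (ε ρ : ℝ) : ℝ :=
  (1 + ρ ^ 2 / ε ^ 2) ^ (-(ℓ : ℝ) / 2) / varsig T ε ρ

/-- The two usual expressions for `T_k` agree. -/
theorem arnoldiT_eq (A : Matrix (Fin n) (Fin n) ℝ) (v : EuclideanSpace ℝ (Fin n)) (γ : ℝ) (k : ℕ)
    (hγ : γ ≠ 0) (hU : IsUnit (1 + γ • arnoldiH A v k)) :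
    arnoldiT A v γ k = γ⁻¹ • ((arnoldiQ A v γ k)⁻¹ - 1) := by
  unfold arnoldiT arnoldiQ
  generalize hB : 1 + γ • arnoldiH A v k = B at hU
  generalize arnoldiSub A v (k - 1) = h
  have hBH : IsUnit Bᴴ.det := by
    have := (Matrix.isUnit_iff_isUnit_det _).1 hU
    rw [Matrix.det_conjTranspose]; exact this.star
  have hH : arnoldiH A v k = γ⁻¹ • (B - 1) := by
    rw [← hB, add_sub_cancel_left, smul_smul, inv_mul_cancel₀ hγ, one_smul]
  set E := Matrix.vecMulVec (eLast k) (eLast k) with hE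
  have hM : IsUnit (Bᴴ * B + (γ ^ 2 * h ^ 2) • E) := by
    have h1 : (Bᴴ * B).PosDef :=
      Matrix.PosDef.conjTranspose_mul_self B (Matrix.mulVec_injective_of_isUnit hU)
    have h2 : ((γ ^ 2 * h ^ 2) • E).PosSemidef := by
      have : E.PosSemidef := by
        have := Matrix.posSemidef_vecMulVec_self_star (eLast k)
        simpa [hE] using this
      exact this.smul (by positivity)
    exact (h1.add_posSemidef h2).isUnit
  rw [Matrix.mul_inv_rev, Matrix.nonsing_inv_nonsing_inv _ ((Matrix.isUnit_iff_isUnit_det _).1 hM),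
    Matrix.mul_add, ← Matrix.mul_assoc, Matrix.nonsing_inv_mul _ hBH, Matrix.one_mul, hH,
    Matrix.mul_smul, add_sub_right_comm, smul_add, smul_smul]
  congr 2
  field_simp

end

end HarmonicArnoldi

/-! The proof is a Laplace-transform estimate of the error. Write `V`, `T` for `V_k`, `T_k`. Since
`T` differs from `H_k` only in its last column, the Arnoldi relation becomes `A V = V T + u e_kᵀ`
for a fixed vector `u` (`exists_mul_arnoldiV_eq`). The matrix `s^ℓ φ_ℓ(-sM)` solves `Y' = -M Y +
f_ℓ(s) I` with `f_0 = 0` and `f_ℓ(s) = s^(ℓ-1)/(ℓ-1)!` otherwise (`hasDerivAt_scaledPhi_apply`).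
Because `V β e_1 = v`, the forcing terms cancel in `g(s) = s^ℓ ê(s)`, leaving `g' = -A g - η(s) u`,
`g(0) = 0`, where `η(s) = e_kᵀ s^ℓ φ_ℓ(-sT) β e_1`. The same `u` gives the residual: `r̂(t) = -β
(e_kᵀ φ_ℓ(-tT) e_1) u` (`resid_eq`), so a bound in terms of `‖u‖` is a bound in terms of `‖r̂(t)‖`.

For `Re z > 0` the transforms satisfy `(z + A) ĝ(z) = -η̂(z) u`, and `η̂(z)` is the last component
of the solution of `(z + T) x = β z^(-ℓ) e_1`. The numerical range of `A` bounds the resolvent by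
`1/(Re z + a)` (`mul_norm_le_norm_resolvent`). By Cramer's rule and the Hessenberg structure,
`|η̂(z)| = β |z|^(-ℓ) ∏ h_{j+1,j} / |det(z + T)|` (`det_mul_last_eq`). On the line `Re z = ε` the
determinant is at least `ω(ε) ς(ρ)`, by pairing each eigenvalue with its conjugate
(`omega_mul_varsig_le_norm_det`). Fourier inversion along this line (`norm_le_of_norm_laplace_le`)
then bounds `g(t)`; the bound is even in `ρ`, which turns the factor `1/(2π)` into `1/π` over the
half-line. -/

open scoped Matrix Nat

namespace HarmonicArnoldi

noncomputable section

/-! ### Laplace transform of functions of polynomial growth, and its inversion -/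

section Laplace

open MeasureTheory Filter Asymptotics Set
open scoped Topology FourierTransform

variable {E : Type*} [NormedAddCommGroup E] [NormedSpace ℂ E]

/-- The Laplace transform of a vector-valued function. -/
def laplace (y : ℝ → E) (z : ℂ) : E := ∫ s in Ioi (0 : ℝ), Complex.exp (-z * s) • y s

/-- Polynomial growth at `+∞`. -/
def PolyGrowth (y : ℝ → E) : Prop := ∃ m : ℕ, y =O[atTop] fun s : ℝ => s ^ m

lemma norm_cexp_neg_mul (z : ℂ) (s : ℝ) :
    ‖Complex.exp (-z * s)‖ = Real.exp (-z.re * s) := by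
  rw [Complex.norm_exp]; simp

/-- Half of the decay rate is spent on absorbing the polynomial factor; the other half remains. -/
lemma PolyGrowth.isBigO_exp {y : ℝ → E} (hy : PolyGrowth y) {z : ℂ} (hz : 0 < z.re) :
    (fun s : ℝ => Complex.exp (-z * s) • y s) =O[atTop] fun s => Real.exp (-(z.re / 2) * s) := by
  obtain ⟨m, hm⟩ := hy
  have h1 : y =O[atTop] fun s => Real.exp (z.re / 2 * s) :=
    hm.trans (isLittleO_pow_exp_pos_mul_atTop m (half_pos hz)).isBigO
  have h2 : (fun s : ℝ => Complex.exp (-z * s)) =O[atTop] fun s => Real.exp (-z.re * s) := by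
    refine IsBigO.of_bound 1 (Eventually.of_forall fun s => ?_)
    rw [norm_cexp_neg_mul, Real.norm_eq_abs, Real.abs_exp, one_mul]
  refine (h2.smul h1).congr_right fun s => ?_
  rw [smul_eq_mul, ← Real.exp_add]; ring_nf

lemma PolyGrowth.integrableOn {y : ℝ → E} (hy : PolyGrowth y) (hc : Continuous y) {z : ℂ}
    (hz : 0 < z.re) : IntegrableOn (fun s : ℝ => Complex.exp (-z * s) • y s) (Ioi 0) := by
  have hcont : Continuous fun s : ℝ => Complex.exp (-z * s) • y s := by fun_prop
  have h := integrable_of_isBigO_exp_neg (f := fun s => ‖Complex.exp (-z * s) • y s‖)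
    (a := 0) (half_pos hz) hcont.norm.continuousOn (hy.isBigO_exp hz).norm_left
  exact (integrable_norm_iff hcont.aestronglyMeasurable).1 h

lemma PolyGrowth.tendsto_zero {y : ℝ → E} (hy : PolyGrowth y) {z : ℂ} (hz : 0 < z.re) :
    Tendsto (fun s : ℝ => Complex.exp (-z * s) • y s) atTop (𝓝 0) := by
  refine (hy.isBigO_exp hz).trans_tendsto ?_
  refine Real.tendsto_exp_atBot.comp ?_
  exact tendsto_id.const_mul_atTop_of_neg (by linarith)

/-- The Laplace transform of the solution of the linear equation `y' = f - L y`. -/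
lemma laplace_of_hasDerivAt [CompleteSpace E] {y f : ℝ → E} (L : E →L[ℂ] E)
    (hy : ∀ s, HasDerivAt y (f s - L (y s)) s) (hf : Continuous f)
    (gy : PolyGrowth y) (gf : PolyGrowth f) {z : ℂ} (hz : 0 < z.re) :
    z • laplace y z + L (laplace y z) = y 0 + laplace f z := by
  have cy : Continuous y := continuous_iff_continuousAt.2 fun s => (hy s).continuousAt
  have iy := gy.integrableOn cy hz
  have jf := gf.integrableOn hf hz
  have hd : ∀ s : ℝ, HasDerivAt (fun s : ℝ => Complex.exp (-z * s) • y s)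
      (Complex.exp (-z * s) • f s - L (Complex.exp (-z * s) • y s)
        - z • (Complex.exp (-z * s) • y s)) s := by
    intro s
    have h1 : HasDerivAt (fun s : ℝ => Complex.exp (-z * s)) (Complex.exp (-z * s) * (-z * 1)) s :=
      (((Complex.ofRealCLM.hasDerivAt (x := s)).const_mul (-z))).cexp
    refine (h1.smul (hy s)).congr_deriv ?_
    rw [map_smul, smul_sub, smul_smul, mul_one, mul_neg, neg_smul, mul_comm z]
    abel
  have iL : IntegrableOn (fun s : ℝ => L (Complex.exp (-z * s) • y s)) (Ioi 0) :=
    L.integrable_comp iy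
  -- Integrating the derivative of `exp (-z s) y(s)` over the half-line leaves only `-y 0`, since
  -- the boundary term at infinity vanishes.
  have key := integral_Ioi_of_hasDerivAt_of_tendsto (a := 0)
    (hd 0).continuousAt.continuousWithinAt (fun s _ => hd s)
    ((jf.sub iL).sub (iy.smul z)) (gy.tendsto_zero hz)
  have e1 := integral_sub (jf.sub iL) (iy.smul z)
  have e2 := integral_sub jf iL
  have e3 := L.integral_comp_comm iy
  have e4 := integral_smul (μ := volume.restrict (Ioi (0 : ℝ))) z
    (fun s : ℝ => Complex.exp (-z * s) • y s)
  simp only [Pi.sub_apply, Pi.smul_apply] at e1 e2 e4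
  rw [e1, e2, e3, e4] at key
  simp only [Complex.ofReal_zero, mul_zero, Complex.exp_zero, one_smul, zero_sub] at key
  unfold laplace
  rw [sub_eq_iff_eq_add, sub_eq_iff_eq_add] at key
  rw [key]
  abel

/-- The inversion formula for the Laplace transform, as an estimate. -/
lemma norm_le_of_norm_laplace_le [CompleteSpace E] {g : ℝ → E} (hc : Continuous g)
    (h0 : g 0 = 0) (hg : PolyGrowth g) {ε : ℝ} (hε : 0 < ε) {B : ℝ → ℝ} (hB : Integrable B)
    (hle : ∀ ρ : ℝ, ‖laplace g (ε + ρ * Complex.I)‖ ≤ B ρ) {t : ℝ} (ht : 0 < t) :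
    ‖g t‖ ≤ Real.exp (t * ε) * ((2 * Real.pi)⁻¹ * ∫ ρ, B ρ) := by
  have hε' : 0 < (ε : ℂ).re := by simpa using hε
  set f : ℝ → E := (Ioi (0 : ℝ)).indicator fun s : ℝ => Complex.exp (-(ε : ℂ) * s) • g s with hf
  have hfc : Continuous f := by
    -- Since `g 0 = 0`, the cut-off at time zero creates no jump; pointwise Fourier inversion needs
    -- this continuity.
    have h1 : f = fun s : ℝ => Complex.exp (-(ε : ℂ) * s) • g (max s 0) := by
      funext s
      by_cases hs : 0 < s
      · rw [hf, indicator_of_mem (mem_Ioi.2 hs), max_eq_left hs.le]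
      · rw [hf, indicator_of_notMem (by simpa using hs), max_eq_right (not_lt.1 hs), h0, smul_zero]
    rw [h1]
    fun_prop
  have hfi : Integrable f := (hg.integrableOn hc hε').integrable_indicator measurableSet_Ioi
  have hF : ∀ ξ : ℝ, 𝓕 f ξ = laplace g (ε + (2 * Real.pi * ξ : ℝ) * Complex.I) := by
    intro ξ
    rw [Real.fourier_eq', laplace, ← integral_indicator measurableSet_Ioi]
    congr 1
    funext s
    by_cases hs : s ∈ Ioi (0 : ℝ)
    · rw [hf, indicator_of_mem hs, indicator_of_mem hs, smul_smul, ← Complex.exp_add]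
      congr 2
      simp
      ring
    · rw [hf, indicator_of_notMem hs, indicator_of_notMem hs, smul_zero]
  have hFc : Continuous (𝓕 f) :=
    VectorFourier.fourierIntegral_continuous Real.continuous_fourierChar continuous_inner hfi
  have hFle : ∀ ξ, ‖𝓕 f ξ‖ ≤ B (2 * Real.pi * ξ) := fun ξ => by
    rw [hF]; exact hle _
  have hBi : Integrable fun ξ => B (2 * Real.pi * ξ) := hB.comp_mul_left' (by positivity)
  have hFi : Integrable (𝓕 f) :=
    hBi.mono' hFc.aestronglyMeasurable (Eventually.of_forall hFle)
  have hinv : 𝓕⁻ (𝓕 f) t = f t := hfi.fourierInv_fourier_eq hFi hfc.continuousAt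
  have h1 : ‖f t‖ ≤ (2 * Real.pi)⁻¹ * ∫ ρ, B ρ := by
    rw [← hinv, Real.fourierInv_eq']
    -- The substitution `ρ = 2πξ` produces the factor `(2π)⁻¹`.
    have h2 := Measure.integral_comp_mul_left B (2 * Real.pi)
    rw [abs_of_pos (by positivity), smul_eq_mul] at h2
    rw [← h2]
    refine norm_integral_le_of_norm_le hBi (Eventually.of_forall fun ξ => ?_)
    rw [norm_smul, Complex.norm_exp_ofReal_mul_I, one_mul]
    exact hFle ξ
  have h2 : ‖f t‖ = Real.exp (-ε * t) * ‖g t‖ := by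
    rw [hf, indicator_of_mem (mem_Ioi.2 ht), norm_smul, norm_cexp_neg_mul, Complex.ofReal_re]
  rw [h2] at h1
  calc ‖g t‖ = Real.exp (t * ε) * (Real.exp (-ε * t) * ‖g t‖) := by
        rw [← mul_assoc, ← Real.exp_add, show t * ε + -ε * t = 0 by ring, Real.exp_zero, one_mul]
    _ ≤ _ := mul_le_mul_of_nonneg_left h1 (Real.exp_pos _).le

end Laplace


/-! ### Consequences of the sector condition on the numerical range -/

section NumericalRange

variable {ι : Type*} [Fintype ι] [DecidableEq ι]

/-- The embedding of a real vector into complex Euclidean space. -/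
def cvec : (ι → ℝ) →L[ℝ] EuclideanSpace ℂ ι :=
  LinearMap.toContinuousLinearMap
    { toFun := fun x => WithLp.toLp 2 fun i => (x i : ℂ)
      map_add' := fun x y => by ext i; simp
      map_smul' := fun c x => by ext i; simp }

omit [DecidableEq ι] in
lemma cvec_apply (x : ι → ℝ) (i : ι) : cvec x i = (x i : ℂ) := rfl

omit [DecidableEq ι] in
lemma norm_cvec (x : ι → ℝ) : ‖cvec x‖ = ‖(WithLp.toLp 2 x : EuclideanSpace ℝ ι)‖ := by
  simp [EuclideanSpace.norm_eq, cvec_apply]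

lemma toEuclideanLin_toC_cvec (M : Matrix ι ι ℝ) (x : ι → ℝ) :
    Matrix.toEuclideanLin (toC M) (cvec x) = cvec (M *ᵥ x) := by
  ext i
  simp [Matrix.toEuclideanLin, Matrix.toLpLin_apply, toC, Matrix.mulVec, dotProduct, cvec_apply]

omit [DecidableEq ι] in
lemma inner_cvec (x y : ι → ℝ) : inner ℂ (cvec x) (cvec y) = ((x ⬝ᵥ y : ℝ) : ℂ) := by
  simp [PiLp.inner_apply, cvec_apply, dotProduct, mul_comm]

lemma le_re_of_mem_sector {ϑ a : ℝ} (hϑ : ϑ ≤ Real.pi / 2) {z : ℂ} (hz : z ∈ sector ϑ a) :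
    a ≤ z.re := by
  have h := Complex.abs_arg_le_pi_div_two_iff.1 (le_trans (show |_| ≤ ϑ from hz) hϑ)
  simpa using h

lemma mul_norm_sq_le_re_inner {M : Matrix ι ι ℝ} {ϑ a : ℝ} (hϑ : ϑ ≤ Real.pi / 2)
    (hM : numRange (toC M) ⊆ sector ϑ a) (x : EuclideanSpace ℂ ι) :
    a * ‖x‖ ^ 2 ≤ (inner ℂ x (Matrix.toEuclideanLin (toC M) x)).re := by
  rcases eq_or_ne x 0 with rfl | hx
  · simp
  have h := le_re_of_mem_sector hϑ (hM ⟨x, hx, rfl⟩)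
  rw [inner_self_eq_norm_sq_to_K, RCLike.ofReal_eq_complex_ofReal] at h
  have h2 : (0 : ℝ) < ‖x‖ ^ 2 := by positivity
  rw [show ((‖x‖ : ℂ)) ^ 2 = ((‖x‖ ^ 2 : ℝ) : ℂ) by push_cast; rfl, Complex.div_ofReal_re,
    le_div_iff₀ h2] at h
  exact h

lemma dotProduct_mulVec_nonneg {M : Matrix ι ι ℝ} {ϑ a : ℝ} (ha : 0 ≤ a) (hϑ : ϑ ≤ Real.pi / 2)
    (hM : numRange (toC M) ⊆ sector ϑ a) (x : ι → ℝ) : 0 ≤ x ⬝ᵥ (M *ᵥ x) := by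
  have h := mul_norm_sq_le_re_inner hϑ hM (cvec x)
  rw [toEuclideanLin_toC_cvec, inner_cvec, Complex.ofReal_re] at h
  exact le_trans (by positivity) h

/-- Cauchy–Schwarz applied to `Re (x, (z + M) x) ≥ (Re z + a) ‖x‖²`, followed by division by `‖x‖`.
This is the resolvent bound in a form that needs no inverse. -/
lemma mul_norm_le_norm_resolvent {M : Matrix ι ι ℝ} {ϑ a : ℝ} (hϑ : ϑ ≤ Real.pi / 2)
    (hM : numRange (toC M) ⊆ sector ϑ a) (z : ℂ) (x : EuclideanSpace ℂ ι) :
    (z.re + a) * ‖x‖ ≤ ‖z • x + Matrix.toEuclideanLin (toC M) x‖ := by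
  rcases eq_or_ne x 0 with rfl | hx
  · simp
  have h := mul_norm_sq_le_re_inner hϑ hM x
  have h1 : (z.re + a) * ‖x‖ ^ 2 ≤
      (inner ℂ x (z • x + Matrix.toEuclideanLin (toC M) x)).re := by
    rw [inner_add_right, inner_smul_right, inner_self_eq_norm_sq_to_K, Complex.add_re,
      RCLike.ofReal_eq_complex_ofReal]
    rw [show ((‖x‖ : ℂ)) ^ 2 = ((‖x‖ ^ 2 : ℝ) : ℂ) by push_cast; rfl, Complex.re_mul_ofReal]
    linarith
  have h2 := h1.trans ((Complex.re_le_norm _).trans (norm_inner_le_norm _ _))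
  have h3 : 0 < ‖x‖ := norm_pos_iff.2 hx
  nlinarith

end NumericalRange

/-! ### Matrix exponential, bounds on `φ_ℓ`, and the differential equation of `s ^ ℓ φ_ℓ(-s M)` -/

section Phi

open intervalIntegral MeasureTheory Filter Asymptotics
open scoped Topology

variable {ι : Type*} [Fintype ι] [DecidableEq ι]

attribute [local instance] Matrix.linftyOpNormedRing Matrix.linftyOpNormedAlgebra

lemma exp_add_smul (M : Matrix ι ι ℝ) (s r : ℝ) :
    NormedSpace.exp ((s + r) • M) = NormedSpace.exp (s • M) * NormedSpace.exp (r • M) := by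
  rw [add_smul]
  exact Matrix.exp_add_of_commute _ _ (((Commute.refl M).smul_left s).smul_right r)

lemma hasDerivAt_exp_neg_smul (M : Matrix ι ι ℝ) (s : ℝ) :
    HasDerivAt (fun s : ℝ => NormedSpace.exp (-s • M)) (-(M * NormedSpace.exp (-s • M))) s := by
  have h := (hasDerivAt_exp_smul_const' (𝕂 := ℝ) M (-s)).scomp s (hasDerivAt_neg s)
  rw [neg_one_smul] at h
  exact h

lemma hasDerivAt_exp_neg_smul_apply (M : Matrix ι ι ℝ) (i j : ι) (s : ℝ) :
    HasDerivAt (fun s : ℝ => NormedSpace.exp (-s • M) i j) (-(M * NormedSpace.exp (-s • M)) i j) s :=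
  (LinearMap.toContinuousLinearMap (Matrix.entryLinearMap ℝ ℝ i j)).hasFDerivAt.comp_hasDerivAt s
    (hasDerivAt_exp_neg_smul M s)

lemma continuous_exp_smul (M : Matrix ι ι ℝ) :
    Continuous fun s : ℝ => NormedSpace.exp (s • M) :=
  continuous_iff_continuousAt.2 fun s => (hasDerivAt_exp_smul_const' (𝕂 := ℝ) M s).continuousAt

/-- If the quadratic form of `M` is nonnegative, the semigroup `exp (-s M)` is contractive. -/
lemma norm_exp_neg_smul_mulVec_le {M : Matrix ι ι ℝ} (hM : ∀ x : ι → ℝ, 0 ≤ x ⬝ᵥ (M *ᵥ x))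
    (b : ι → ℝ) {s : ℝ} (hs : 0 ≤ s) :
    (NormedSpace.exp (-s • M) *ᵥ b) ⬝ᵥ (NormedSpace.exp (-s • M) *ᵥ b) ≤ b ⬝ᵥ b := by
  have hz : ∀ s : ℝ, HasDerivAt (fun s : ℝ => NormedSpace.exp (-s • M) *ᵥ b)
      (-(M *ᵥ (NormedSpace.exp (-s • M) *ᵥ b))) s := by
    intro s
    refine hasDerivAt_pi.2 fun i => ?_
    refine (HasDerivAt.fun_sum (u := Finset.univ) fun j _ =>
      (hasDerivAt_exp_neg_smul_apply M i j s).mul_const (b j)).congr_deriv ?_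
    rw [Matrix.mulVec_mulVec]
    simp [Matrix.mulVec, dotProduct]
  have hd : ∀ s : ℝ, HasDerivAt (fun s : ℝ =>
      (NormedSpace.exp (-s • M) *ᵥ b) ⬝ᵥ (NormedSpace.exp (-s • M) *ᵥ b))
      (-2 * ((NormedSpace.exp (-s • M) *ᵥ b) ⬝ᵥ (M *ᵥ (NormedSpace.exp (-s • M) *ᵥ b)))) s := by
    intro s
    have h := HasDerivAt.fun_sum (u := Finset.univ) fun i _ =>
      ((hasDerivAt_pi.1 (hz s) i).mul (hasDerivAt_pi.1 (hz s) i))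
    refine h.congr_deriv ?_
    simp only [dotProduct, Finset.mul_sum]
    refine Finset.sum_congr rfl fun i _ => ?_
    simp only [Pi.neg_apply]
    ring
  -- The squared norm of `y(s) = exp (-s M) b` has derivative `-2 (y, M y) ≤ 0`.
  have hanti : Antitone fun s : ℝ =>
      (NormedSpace.exp (-s • M) *ᵥ b) ⬝ᵥ (NormedSpace.exp (-s • M) *ᵥ b) := by
    refine antitone_of_deriv_nonpos (fun s => (hd s).differentiableAt) fun s => ?_
    rw [(hd s).deriv]
    have := hM (NormedSpace.exp (-s • M) *ᵥ b)
    linarith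
  simpa [NormedSpace.exp_zero] using hanti hs

lemma abs_exp_neg_smul_apply_le {M : Matrix ι ι ℝ} (hM : ∀ x : ι → ℝ, 0 ≤ x ⬝ᵥ (M *ᵥ x))
    {s : ℝ} (hs : 0 ≤ s) (i j : ι) : |NormedSpace.exp (-s • M) i j| ≤ 1 := by
  have h := norm_exp_neg_smul_mulVec_le hM (Pi.single j 1) hs
  rw [Matrix.mulVec_single_one] at h
  simp only [dotProduct_single, Pi.single_eq_same, mul_one] at h
  have h2 : NormedSpace.exp (-s • M) i j * NormedSpace.exp (-s • M) i j ≤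
      (NormedSpace.exp (-s • M)).col j ⬝ᵥ (NormedSpace.exp (-s • M)).col j :=
    Finset.single_le_sum (f := fun i => NormedSpace.exp (-s • M) i j * NormedSpace.exp (-s • M) i j)
      (fun i _ => mul_self_nonneg _) (Finset.mem_univ i)
  exact abs_le_one_iff_mul_self_le_one.2 (h2.trans h)

lemma abs_phi_neg_smul_apply_le {M : Matrix ι ι ℝ} (hM : ∀ x : ι → ℝ, 0 ≤ x ⬝ᵥ (M *ᵥ x)) (ℓ : ℕ)
    {s : ℝ} (hs : 0 ≤ s) (i j : ι) : |phi ℓ (-s • M) i j| ≤ 1 := by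
  cases ℓ with
  | zero => exact abs_exp_neg_smul_apply_le hM hs i j
  | succ ℓ =>
    have h1 : |∫ θ in (0 : ℝ)..1, NormedSpace.exp ((1 - θ) • (-s • M)) i j * θ ^ ℓ| ≤ 1 := by
      have := intervalIntegral.norm_integral_le_of_norm_le_const (a := 0) (b := 1) (C := 1)
        (f := fun θ : ℝ => NormedSpace.exp ((1 - θ) • (-s • M)) i j * θ ^ ℓ) fun θ hθ => by
          rw [Set.uIoc_of_le zero_le_one] at hθ
          rw [norm_mul, smul_smul, mul_neg]
          refine mul_le_one₀ (abs_exp_neg_smul_apply_le hM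
            (mul_nonneg (sub_nonneg.2 hθ.2) hs) i j) (norm_nonneg _) ?_
          rw [norm_pow, Real.norm_eq_abs, abs_of_pos hθ.1]
          exact pow_le_one₀ hθ.1.le hθ.2
      simpa using this
    rw [phi, Matrix.of_apply, abs_mul]
    refine mul_le_one₀ ?_ (abs_nonneg _) h1
    rw [abs_of_pos (by positivity), div_le_one (by positivity)]
    exact_mod_cast Nat.succ_le_of_lt (Nat.factorial_pos ℓ)

/-- The inhomogeneity of the differential equation satisfied by `s ^ ℓ φ_ℓ(-s M)`. -/
def forcing : ℕ → ℝ → ℝ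
  | 0, _ => 0
  | ℓ + 1, s => s ^ ℓ / (ℓ ! : ℝ)

/-- The matrix `s ^ ℓ φ_ℓ(-s M)`. -/
def scaledPhi (ℓ : ℕ) (M : Matrix ι ι ℝ) (s : ℝ) : Matrix ι ι ℝ := s ^ ℓ • phi ℓ (-s • M)

/-- Substituting `τ = s θ` and factoring `exp (-s M)` out gives the variation-of-constants form. The
parameter `s` is left only in a prefactor and in the upper limit, so the product rule and the
fundamental theorem of calculus apply. -/
lemma scaledPhi_succ_apply (ℓ : ℕ) (M : Matrix ι ι ℝ) (s : ℝ) (i j : ι) :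
    scaledPhi (ℓ + 1) M s i j = ∑ m, NormedSpace.exp (-s • M) i m *
      ∫ τ in (0 : ℝ)..s, τ ^ ℓ / (ℓ ! : ℝ) * NormedSpace.exp (τ • M) m j := by
  have hc := fun m => (continuous_exp_smul M).matrix_elem m j
  simp only [← intervalIntegral.integral_const_mul]
  rw [← intervalIntegral.integral_finsetSum
    fun m _ => Continuous.intervalIntegrable (by have := hc m; fun_prop) _ _]
  rw [scaledPhi, phi, Matrix.smul_apply, Matrix.of_apply, smul_eq_mul]
  have h2 := intervalIntegral.mul_integral_comp_mul_left (a := 0) (b := 1)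
    (f := fun τ => ∑ m, NormedSpace.exp (-s • M) i m *
      (τ ^ ℓ / (ℓ ! : ℝ) * NormedSpace.exp (τ • M) m j)) s
  rw [mul_zero, mul_one] at h2
  rw [← h2, ← mul_assoc, ← intervalIntegral.integral_const_mul,
    ← intervalIntegral.integral_const_mul]
  refine intervalIntegral.integral_congr fun θ _ => ?_
  simp only [smul_smul]
  rw [show (1 - θ) * -s = -s + s * θ by ring, exp_add_smul, Matrix.mul_apply, Finset.sum_mul,
    Finset.mul_sum, Finset.mul_sum]
  refine Finset.sum_congr rfl fun m _ => ?_
  ring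

lemma hasDerivAt_scaledPhi_apply (ℓ : ℕ) (M : Matrix ι ι ℝ) (i j : ι) (s : ℝ) :
    HasDerivAt (fun s => scaledPhi ℓ M s i j)
      (-(M * scaledPhi ℓ M s) i j + forcing ℓ s * (1 : Matrix ι ι ℝ) i j) s := by
  cases ℓ with
  | zero =>
    have h : scaledPhi 0 M = fun s : ℝ => NormedSpace.exp (-s • M) := by
      funext s; simp [scaledPhi, phi]
    rw [h]
    simpa [forcing] using hasDerivAt_exp_neg_smul_apply M i j s
  | succ ℓ =>
    have hc : ∀ m, Continuous fun τ : ℝ => τ ^ ℓ / (ℓ ! : ℝ) * NormedSpace.exp (τ • M) m j := by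
      intro m
      have := (continuous_exp_smul M).matrix_elem m j
      fun_prop
    have h := HasDerivAt.fun_sum (u := Finset.univ) fun m _ =>
      (hasDerivAt_exp_neg_smul_apply M i m s).mul
        (intervalIntegral.integral_hasDerivAt_right ((hc m).intervalIntegrable 0 s)
          ((hc m).stronglyMeasurableAtFilter _ _) (hc m).continuousAt)
    simp only [scaledPhi_succ_apply]
    refine h.congr_deriv ?_
    rw [Finset.sum_add_distrib]
    congr 1
    · rw [Matrix.mul_apply]
      simp only [scaledPhi_succ_apply, Matrix.mul_apply, neg_mul, Finset.sum_neg_distrib, neg_inj,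
        Finset.mul_sum, Finset.sum_mul]
      rw [Finset.sum_comm]
      simp only [mul_assoc]
    · have h1 : NormedSpace.exp (-s • M) * NormedSpace.exp (s • M) = 1 := by
        rw [← exp_add_smul, neg_add_cancel, zero_smul, NormedSpace.exp_zero]
      rw [← h1, Matrix.mul_apply, forcing, Finset.mul_sum]
      refine Finset.sum_congr rfl fun m _ => ?_
      ring

lemma scaledPhi_zero_right (ℓ : ℕ) (M : Matrix ι ι ℝ) :
    scaledPhi ℓ M 0 = if ℓ = 0 then 1 else 0 := by
  cases ℓ with
  | zero => simp [scaledPhi, phi, NormedSpace.exp_zero]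
  | succ ℓ => simp [scaledPhi]

end Phi


/-! ### Lower bound for the characteristic polynomial and integrability of the integrand -/

section Eigenvalues

open MeasureTheory
open scoped ComplexConjugate

variable {k : ℕ}

/-- For an eigenvector `x` of `μ`, the resolvent inequality at `z = -μ` reads `(a - Re μ) ‖x‖ ≤ 0`.
-/
lemma le_re_of_mem_eigs {T : Matrix (Fin k) (Fin k) ℝ} {ϑ a : ℝ} (hϑ : ϑ ≤ Real.pi / 2)
    (hT : numRange (toC T) ⊆ sector ϑ a) {μ : ℂ} (hμ : μ ∈ eigs T) : a ≤ μ.re := by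
  have h1 := (Polynomial.mem_roots'.1 hμ).2
  rw [Polynomial.IsRoot, Matrix.eval_charpoly] at h1
  obtain ⟨x, hx, hx0⟩ := Matrix.exists_mulVec_eq_zero_iff.2 h1
  have h2 := mul_norm_le_norm_resolvent hϑ hT (-μ) (WithLp.toLp 2 x)
  have h3 : (-μ) • (WithLp.toLp 2 x : EuclideanSpace ℂ (Fin k)) +
      Matrix.toEuclideanLin (toC T) (WithLp.toLp 2 x) = 0 := by
    ext i
    have := congrFun hx0 i
    rw [Matrix.sub_mulVec] at this
    simp [Matrix.scalar_apply] at this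
    simp [Matrix.toEuclideanLin, Matrix.toLpLin_apply]
    linear_combination -this
  have h4 : 0 < ‖(WithLp.toLp 2 x : EuclideanSpace ℂ (Fin k))‖ :=
    norm_pos_iff.2 fun h => hx (by simpa using h)
  rw [h3, norm_zero, Complex.neg_re] at h2
  by_contra hlt
  have : 0 < (-μ.re + a) * ‖(WithLp.toLp 2 x : EuclideanSpace ℂ (Fin k))‖ :=
    mul_pos (by linarith) h4
  linarith

lemma card_eigs (T : Matrix (Fin k) (Fin k) ℝ) : Multiset.card (eigs T) = k := by
  rw [eigs, ← (IsAlgClosed.splits (toC T).charpoly).natDegree_eq_card_roots,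
    Matrix.charpoly_natDegree_eq_dim, Fintype.card_fin]

lemma norm_det_smul_one_add (T : Matrix (Fin k) (Fin k) ℝ) (z : ℂ) :
    ‖(z • (1 : Matrix (Fin k) (Fin k) ℂ) + toC T).det‖ =
      ((eigs T).map fun μ => ‖z + μ‖).prod := by
  have h := (IsAlgClosed.splits (toC T).charpoly).eval_eq_prod_roots_of_monic
    (Matrix.charpoly_monic _) (-z)
  rw [Matrix.eval_charpoly] at h
  have h2 : z • (1 : Matrix (Fin k) (Fin k) ℂ) + toC T =
      -(Matrix.scalar (Fin k) (-z) - toC T) := by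
    ext i j
    by_cases hij : i = j
    · subst hij
      simp
      ring
    · simp [hij]
  rw [h2, Matrix.det_neg, h, norm_mul, norm_pow, norm_neg, norm_one, one_pow, one_mul]
  change ‖((eigs T).map fun μ => -z - μ).prod‖ = _
  induction eigs T using Multiset.induction with
  | empty => simp
  | cons μ s ih =>
    rw [Multiset.map_cons, Multiset.prod_cons, norm_mul, ih, Multiset.map_cons, Multiset.prod_cons,
      show -z - μ = -(z + μ) by ring, norm_neg]

/-- The characteristic polynomial has real coefficients, so conjugation permutes its roots with
multiplicity. -/
lemma map_conj_eigs (T : Matrix (Fin k) (Fin k) ℝ) : (eigs T).map conj = eigs T := by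
  have h := (IsAlgClosed.splits (toC T).charpoly).roots_map (starRingEnd ℂ)
  have h2 : (toC T).charpoly.map (starRingEnd ℂ) = (toC T).charpoly := by
    rw [← Matrix.charpoly_map]
    congr 1
    ext i j
    simp [toC]
  rw [h2] at h
  exact h.symm

/-- The contribution of the eigenvalue `μ` to the product `ω(ε) ς(ρ)`. -/
def weight (ε ρ : ℝ) (μ : ℂ) : ℝ :=
  (rad ε μ * (ε + μ.re)) ^ ((1 : ℝ) / 2) *
    (1 + ρ ^ 2 / rad ε μ ^ 2) ^ (if μ.im = 0 then (1 : ℝ) / 2 else (1 : ℝ) / 4)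

lemma varsig_eq_prod (T : Matrix (Fin k) (Fin k) ℝ) (ε ρ : ℝ) :
    varsig T ε ρ = ((eigs T).map fun μ =>
      (1 + ρ ^ 2 / rad ε μ ^ 2) ^ (if μ.im = 0 then (1 : ℝ) / 2 else (1 : ℝ) / 4)).prod := by
  rw [varsig, realEigs, nonrealEigs]
  conv_rhs => rw [← Multiset.filter_add_not (fun μ : ℂ => μ.im = 0) (eigs T), Multiset.map_add,
    Multiset.prod_add]
  congr 2
  · refine Multiset.map_congr rfl fun μ hμ => ?_
    rw [if_pos (Multiset.mem_filter.1 hμ).2]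
  · refine Multiset.map_congr rfl fun μ hμ => ?_
    rw [if_neg (Multiset.mem_filter.1 hμ).2]

lemma omega_mul_varsig (T : Matrix (Fin k) (Fin k) ℝ) (ε ρ : ℝ) :
    omega T ε * varsig T ε ρ = ((eigs T).map (weight ε ρ)).prod := by
  rw [varsig_eq_prod, omega, ← Multiset.prod_map_mul]
  rfl

lemma rad_eq_sqrt (ε : ℝ) (μ : ℂ) : rad ε μ = √((ε + μ.re) ^ 2 + μ.im ^ 2) :=
  (Real.sqrt_eq_rpow _).symm

lemma rad_pos {ε : ℝ} {μ : ℂ} (h : 0 < ε + μ.re) : 0 < rad ε μ := by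
  rw [rad_eq_sqrt]; positivity

lemma rad_sq (ε : ℝ) (μ : ℂ) : rad ε μ ^ 2 = (ε + μ.re) ^ 2 + μ.im ^ 2 := by
  rw [rad_eq_sqrt, Real.sq_sqrt (by positivity)]

/-- Put `α = ε + Re μ`, `b = Im μ`, `r² = α² + b²`. After one more squaring the right side is `(α² +
(ρ + b)²)(α² + (ρ - b)²)`. For real `μ` the left side equals it. For non-real `μ` the left side is
`α² (r² + ρ²)`, and the difference is `α² (ρ² + b²) + (ρ² - b²)² ≥ 0`. A single factor `‖z + μ‖` can
dip near `ρ = -b`, which is why it is paired with the conjugate one. -/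
lemma weight_sq_le {ε : ℝ} (ρ : ℝ) {μ : ℂ} (h : 0 < ε + μ.re) :
    weight ε ρ μ ^ 2 ≤ ‖(ε + ρ * Complex.I : ℂ) + μ‖ * ‖(ε + ρ * Complex.I : ℂ) + conj μ‖ := by
  have hr := rad_pos h
  have hrs := rad_sq ε μ
  refine (abs_le_of_sq_le_sq' ?_ (by positivity)).2
  have hn : ∀ μ : ℂ, ‖(ε + ρ * Complex.I : ℂ) + μ‖ ^ 2 = (ε + μ.re) ^ 2 + (ρ + μ.im) ^ 2 := by
    intro μ
    rw [Complex.sq_norm, Complex.normSq_apply]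
    simp
    ring
  rw [mul_pow, hn, hn, Complex.conj_re, Complex.conj_im, weight, mul_pow, mul_pow]
  have e1 : (((rad ε μ * (ε + μ.re)) ^ ((1 : ℝ) / 2)) ^ 2) ^ 2 = (rad ε μ * (ε + μ.re)) ^ 2 := by
    rw [← Real.rpow_mul_natCast (by positivity)]
    norm_num
  rw [e1, ← pow_mul, ← Real.rpow_mul_natCast (by positivity)]
  have e3 : rad ε μ ^ 2 * (1 + ρ ^ 2 / rad ε μ ^ 2) = rad ε μ ^ 2 + ρ ^ 2 := by
    field_simp
  split_ifs with him
  · have e2 : (1 + ρ ^ 2 / rad ε μ ^ 2) ^ ((1 : ℝ) / 2 * ((2 * 2 : ℕ) : ℝ)) =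
      (1 + ρ ^ 2 / rad ε μ ^ 2) ^ 2 := by
      rw [← Real.rpow_natCast _ 2]; norm_num
    rw [e2]
    have e4 : (ε + μ.re) ^ 2 = rad ε μ ^ 2 := by rw [hrs, him]; ring
    rw [him, e4, mul_pow, e4, show rad ε μ ^ 2 * rad ε μ ^ 2 * (1 + ρ ^ 2 / rad ε μ ^ 2) ^ 2 =
      (rad ε μ ^ 2 * (1 + ρ ^ 2 / rad ε μ ^ 2)) ^ 2 by ring, e3]
    apply le_of_eq
    ring
  · have e2 : (1 + ρ ^ 2 / rad ε μ ^ 2) ^ ((1 : ℝ) / 4 * ((2 * 2 : ℕ) : ℝ)) =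
      (1 + ρ ^ 2 / rad ε μ ^ 2) := by
      norm_num
    rw [e2, mul_pow, mul_right_comm, e3, hrs]
    nlinarith [sq_nonneg (ρ ^ 2 - μ.im ^ 2), mul_nonneg (sq_nonneg (ε + μ.re)) (sq_nonneg ρ),
      mul_nonneg (sq_nonneg (ε + μ.re)) (sq_nonneg μ.im)]

/-- The lower bound for the characteristic polynomial of `T` on the line `Re z = ε`. -/
lemma omega_mul_varsig_le_norm_det {T : Matrix (Fin k) (Fin k) ℝ} {ε : ℝ} (ρ : ℝ)
    (hT : ∀ μ ∈ eigs T, 0 < ε + μ.re) :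
    omega T ε * varsig T ε ρ ≤
      ‖((ε + ρ * Complex.I : ℂ) • (1 : Matrix (Fin k) (Fin k) ℂ) + toC T).det‖ := by
  refine (abs_le_of_sq_le_sq' ?_ (norm_nonneg _)).2
  have h1 := norm_det_smul_one_add T (ε + ρ * Complex.I)
  -- Conjugation symmetry of the spectrum: in the squared determinant one copy of the product is
  -- indexed by `μ`, the other by `conj μ`.
  have h2 : ((eigs T).map fun μ => ‖(ε + ρ * Complex.I : ℂ) + μ‖).prod =
      ((eigs T).map fun μ => ‖(ε + ρ * Complex.I : ℂ) + conj μ‖).prod := by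
    conv_lhs => rw [← map_conj_eigs T, Multiset.map_map]
    rfl
  rw [sq ‖_‖]
  nth_rw 2 [h1]
  rw [h2, h1, ← Multiset.prod_map_mul, omega_mul_varsig, ← Multiset.prod_map_pow]
  exact Multiset.prod_map_le_prod_map₀ _ _ (fun μ hμ => sq_nonneg _)
    fun μ hμ => weight_sq_le ρ (hT μ hμ)

lemma omega_pos {T : Matrix (Fin k) (Fin k) ℝ} {ε : ℝ} (hT : ∀ μ ∈ eigs T, 0 < ε + μ.re) :
    0 < omega T ε := by
  refine Multiset.prod_pos fun x hx => ?_
  obtain ⟨μ, hμ, rfl⟩ := Multiset.mem_map.1 hx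
  have := rad_pos (hT μ hμ)
  have := hT μ hμ
  positivity

lemma varsig_pos (T : Matrix (Fin k) (Fin k) ℝ) (ε ρ : ℝ) : 0 < varsig T ε ρ := by
  rw [varsig_eq_prod]
  refine Multiset.prod_pos fun x hx => ?_
  obtain ⟨μ, hμ, rfl⟩ := Multiset.mem_map.1 hx
  positivity

lemma continuous_multiset_prod_map (s : Multiset ℂ) {F : ℂ → ℝ → ℝ} (hF : ∀ μ, Continuous (F μ)) :
    Continuous fun ρ => (s.map fun μ => F μ ρ).prod :=
  continuous_multiset_prod _ fun μ _ => hF μ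

lemma continuous_integrand (T : Matrix (Fin k) (Fin k) ℝ) (ℓ : ℕ) (ε : ℝ) :
    Continuous (integrand T ℓ ε) := by
  have hv : Continuous (varsig T ε) := by
    have h : varsig T ε = fun ρ => _ := funext (varsig_eq_prod T ε)
    rw [h]
    exact continuous_multiset_prod_map _ fun μ =>
      Continuous.rpow_const (by fun_prop) fun ρ => Or.inl (by positivity)
  refine Continuous.div (Continuous.rpow_const (by fun_prop) fun ρ => Or.inl (by positivity)) hv
    fun ρ => (varsig_pos T ε ρ).ne'

lemma integrand_nonneg (T : Matrix (Fin k) (Fin k) ℝ) (ℓ : ℕ) (ε ρ : ℝ) :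
    0 ≤ integrand T ℓ ε ρ :=
  div_nonneg (by positivity) (varsig_pos T ε ρ).le

lemma integrand_abs (T : Matrix (Fin k) (Fin k) ℝ) (ℓ : ℕ) (ε ρ : ℝ) :
    integrand T ℓ ε |ρ| = integrand T ℓ ε ρ := by
  simp only [integrand, varsig, sq_abs]

/-- Replacing every radius by a common bound `R` decreases each factor. With `k₂` real eigenvalues
the exponents add up to `k₂/2 + (k - k₂)/4 = (k + k₂)/4`. -/
lemma rpow_card_le_varsig {T : Matrix (Fin k) (Fin k) ℝ} {ε R : ℝ} (hT : ∀ μ ∈ eigs T, 0 < ε + μ.re)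
    (hR : ∀ μ ∈ eigs T, rad ε μ ≤ R) (ρ : ℝ) :
    (1 + ρ ^ 2 / R ^ 2) ^ (((k : ℝ) + Multiset.card (realEigs T)) / 4) ≤ varsig T ε ρ := by
  have hb : 0 < 1 + ρ ^ 2 / R ^ 2 := by positivity
  have hle : ∀ μ ∈ eigs T, ∀ p : ℝ, 0 ≤ p →
      (1 + ρ ^ 2 / R ^ 2) ^ p ≤ (1 + ρ ^ 2 / rad ε μ ^ 2) ^ p := by
    intro μ hμ p hp
    have := rad_pos (hT μ hμ)
    have := hR μ hμ
    refine Real.rpow_le_rpow hb.le ?_ hp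
    gcongr
  have hcard : (k : ℝ) = Multiset.card (realEigs T) + Multiset.card (nonrealEigs T) := by
    have := congrArg Multiset.card (Multiset.filter_add_not (fun μ : ℂ => μ.im = 0) (eigs T))
    rw [Multiset.card_add, card_eigs] at this
    exact_mod_cast this.symm
  have h1 : (1 + ρ ^ 2 / R ^ 2) ^ (((k : ℝ) + Multiset.card (realEigs T)) / 4) =
      ((realEigs T).map fun _ => (1 + ρ ^ 2 / R ^ 2) ^ ((1 : ℝ) / 2)).prod *
      ((nonrealEigs T).map fun _ => (1 + ρ ^ 2 / R ^ 2) ^ ((1 : ℝ) / 4)).prod := by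
    rw [Multiset.map_const', Multiset.prod_replicate, Multiset.map_const', Multiset.prod_replicate,
      ← Real.rpow_mul_natCast hb.le, ← Real.rpow_mul_natCast hb.le, ← Real.rpow_add hb, hcard]
    congr 1
    ring
  rw [h1, varsig]
  refine mul_le_mul ?_ ?_ ?_ ?_
  · exact Multiset.prod_map_le_prod_map₀ _ _ (fun _ _ => by positivity)
      fun μ hμ => hle μ (Multiset.mem_of_mem_filter hμ) _ (by norm_num)
  · exact Multiset.prod_map_le_prod_map₀ _ _ (fun _ _ => by positivity)
      fun μ hμ => hle μ (Multiset.mem_of_mem_filter hμ) _ (by norm_num)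
  · exact Multiset.prod_nonneg fun x hx => by
      obtain ⟨μ, hμ, rfl⟩ := Multiset.mem_map.1 hx; positivity
  · exact Multiset.prod_nonneg fun x hx => by
      obtain ⟨μ, hμ, rfl⟩ := Multiset.mem_map.1 hx; positivity

/-- The integrand is at most `(1 + ρ²/R²)` to the power `-(ℓ/2 + (k + k₂)/4)`. The counting
condition says precisely that `ℓ/2 + (k + k₂)/4 ≥ 1`, so `1/(1 + ρ²/R²)` dominates. -/
lemma integrable_integrand {T : Matrix (Fin k) (Fin k) ℝ} {ℓ : ℕ} {ε : ℝ} (hε : 0 < ε)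
    (hT : ∀ μ ∈ eigs T, 0 < ε + μ.re)
    (hcount : 4 ≤ k + Multiset.card (realEigs T) + 2 * ℓ) : Integrable (integrand T ℓ ε) := by
  -- `R` is `ε` plus the sum of all radii: it dominates each radius, and also `ε`, as the factor
  -- with exponent `-ℓ/2` requires.
  obtain ⟨R, hεR, hR⟩ : ∃ R, ε ≤ R ∧ ∀ μ ∈ eigs T, rad ε μ ≤ R := by
    have h0 : ∀ x ∈ (eigs T).map (rad ε), 0 ≤ x := fun x hx => by
      obtain ⟨μ, hμ, rfl⟩ := Multiset.mem_map.1 hx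
      exact (rad_pos (hT μ hμ)).le
    have h1 := Multiset.sum_nonneg h0
    refine ⟨ε + ((eigs T).map (rad ε)).sum, by linarith, fun μ hμ => ?_⟩
    have := Multiset.single_le_sum h0 _ (Multiset.mem_map_of_mem _ hμ)
    linarith
  have hR0 : 0 < R := hε.trans_le hεR
  have hdom : Integrable fun ρ : ℝ => (1 + (R⁻¹ * ρ) ^ 2)⁻¹ :=
    integrable_inv_one_add_sq.comp_mul_left' (inv_ne_zero hR0.ne')
  refine hdom.mono' (continuous_integrand T ℓ ε).aestronglyMeasurable
    (Filter.Eventually.of_forall fun ρ => ?_)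
  rw [Real.norm_of_nonneg (integrand_nonneg T ℓ ε ρ), integrand]
  have hb : 1 ≤ 1 + ρ ^ 2 / R ^ 2 := le_add_of_nonneg_right (by positivity)
  have hb0 : 0 < 1 + ρ ^ 2 / R ^ 2 := by positivity
  have h1 : (1 + ρ ^ 2 / ε ^ 2) ^ (-(ℓ : ℝ) / 2) ≤ (1 + ρ ^ 2 / R ^ 2) ^ (-(ℓ : ℝ) / 2) := by
    refine Real.rpow_le_rpow_of_nonpos hb0 (by gcongr) ?_
    have : (0 : ℝ) ≤ ℓ := by positivity
    linarith
  have hc : (4 : ℝ) ≤ k + Multiset.card (realEigs T) + 2 * ℓ := by exact_mod_cast hcount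
  calc _ ≤ (1 + ρ ^ 2 / R ^ 2) ^ (-(ℓ : ℝ) / 2) /
        (1 + ρ ^ 2 / R ^ 2) ^ (((k : ℝ) + Multiset.card (realEigs T)) / 4) :=
        div_le_div₀ (by positivity) h1 (by positivity) (rpow_card_le_varsig hT hR ρ)
    _ = (1 + ρ ^ 2 / R ^ 2) ^ (-(ℓ : ℝ) / 2 - ((k : ℝ) + Multiset.card (realEigs T)) / 4) :=
        (Real.rpow_sub hb0 _ _).symm
    _ ≤ (1 + ρ ^ 2 / R ^ 2) ^ (-1 : ℝ) := Real.rpow_le_rpow_of_exponent_le hb (by linarith)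
    _ = (1 + (R⁻¹ * ρ) ^ 2)⁻¹ := by rw [Real.rpow_neg_one]; congr 2; field_simp

end Eigenvalues


/-! ### The Arnoldi relation for `T_k` and Cramer's rule -/

section ArnoldiRelations

variable {n : ℕ}

/-- The matrix `V_k` whose columns are the first `k` Arnoldi vectors. -/
def arnoldiV (A : Matrix (Fin n) (Fin n) ℝ) (v : EuclideanSpace ℝ (Fin n)) (k : ℕ) :
    Matrix (Fin n) (Fin k) ℝ :=
  Matrix.of fun p j => arnoldiVec A v j p

lemma arnoldiVec_zero (A : Matrix (Fin n) (Fin n) ℝ) (v : EuclideanSpace ℝ (Fin n)) :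
    arnoldiVec A v 0 = ‖v‖⁻¹ • v := by
  rw [arnoldiVec]

lemma arnoldiVec_succ (A : Matrix (Fin n) (Fin n) ℝ) (v : EuclideanSpace ℝ (Fin n)) (j : ℕ) :
    arnoldiVec A v (j + 1) = (arnoldiSub A v j)⁻¹ • arnoldiRem A v j := by
  rw [arnoldiVec]
  rfl

lemma toEuclideanLin_arnoldiVec (A : Matrix (Fin n) (Fin n) ℝ) (v : EuclideanSpace ℝ (Fin n))
    (j : ℕ) :
    Matrix.toEuclideanLin A (arnoldiVec A v j) =
      ∑ i ∈ Finset.range (j + 1),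
        (inner ℝ (arnoldiVec A v i) (Matrix.toEuclideanLin A (arnoldiVec A v j)) : ℝ) •
          arnoldiVec A v i + arnoldiSub A v j • arnoldiVec A v (j + 1) := by
  have h : arnoldiSub A v j • arnoldiVec A v (j + 1) = arnoldiRem A v j := by
    rw [arnoldiVec_succ]
    -- If the coefficient vanishes, so does the remainder of which it is the norm; the recurrence
    -- thus persists at a breakdown.
    rcases eq_or_ne (arnoldiSub A v j) 0 with h0 | h0
    · rw [h0, zero_smul, eq_comm, ← norm_eq_zero]
      exact h0
    · rw [smul_inv_smul₀ h0]
  rw [h, arnoldiRem, Fin.sum_univ_eq_sum_range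
    (fun i => (inner ℝ (arnoldiVec A v i) (Matrix.toEuclideanLin A (arnoldiVec A v j)) : ℝ) •
          arnoldiVec A v i)]
  abel

lemma mul_arnoldiV (A : Matrix (Fin n) (Fin n) ℝ) (v : EuclideanSpace ℝ (Fin n)) (m : ℕ) :
    A * arnoldiV A v (m + 1) = arnoldiV A v (m + 1) * arnoldiH A v (m + 1) +
      Matrix.vecMulVec (arnoldiSub A v m • (arnoldiVec A v (m + 1)).ofLp) (eLast (m + 1)) := by
  ext p j
  have h1 : (A * arnoldiV A v (m + 1)) p j = Matrix.toEuclideanLin A (arnoldiVec A v j) p := by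
    simp [Matrix.toEuclideanLin, Matrix.toLpLin_apply, Matrix.mul_apply, Matrix.mulVec, dotProduct,
      arnoldiV]
  have h2 : (arnoldiV A v (m + 1) * arnoldiH A v (m + 1)) p j =
      ∑ i ∈ Finset.range (m + 1), arnoldiVec A v i p *
        (if i ≤ (j : ℕ) then
          inner ℝ (arnoldiVec A v i) (Matrix.toEuclideanLin A (arnoldiVec A v j))
        else if i = j + 1 then arnoldiSub A v j else 0) := by
    rw [Matrix.mul_apply, ← Fin.sum_univ_eq_sum_range (fun i => arnoldiVec A v i p *
        (if i ≤ (j : ℕ) then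
          inner ℝ (arnoldiVec A v i) (Matrix.toEuclideanLin A (arnoldiVec A v j))
        else if i = j + 1 then arnoldiSub A v j else 0))]
    rfl
  have h3 : ∑ i ∈ Finset.range ((j : ℕ) + 1), arnoldiVec A v i p *
        (if i ≤ (j : ℕ) then
          inner ℝ (arnoldiVec A v i) (Matrix.toEuclideanLin A (arnoldiVec A v j))
        else if i = j + 1 then arnoldiSub A v j else 0) =
      ∑ i ∈ Finset.range ((j : ℕ) + 1),
        (inner ℝ (arnoldiVec A v i) (Matrix.toEuclideanLin A (arnoldiVec A v j)) : ℝ) *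
          arnoldiVec A v i p := by
    refine Finset.sum_congr rfl fun i hi => ?_
    rw [if_pos (Nat.lt_succ_iff.1 (Finset.mem_range.1 hi)), mul_comm]
  rw [h1, toEuclideanLin_arnoldiVec, Matrix.add_apply, h2, Matrix.vecMulVec_apply]
  simp only [PiLp.add_apply, WithLp.ofLp_sum, Finset.sum_apply, PiLp.smul_apply, smul_eq_mul,
    Pi.smul_apply, WithLp.ofLp_smul, eLast]
  rw [← h3]
  -- In the last column the subdiagonal entry falls outside `H` and becomes the rank-one term. In
  -- any other column the entries from row `j + 2` on vanish.
  by_cases hj : (j : ℕ) = m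
  · simp only [hj, if_true, mul_one]
  · have hjm : (j : ℕ) + 2 ≤ m + 1 := by have := j.2; omega
    rw [if_neg (by omega), mul_zero, add_zero]
    rw [← Finset.sum_subset (Finset.range_subset_range.2 hjm), Finset.sum_range_succ _ ((j : ℕ) + 1)]
    · rw [if_neg (by omega), if_pos rfl, mul_comm (arnoldiSub A v j)]
    · intro i _ hi
      rw [Finset.mem_range] at hi
      rw [if_neg (by omega), if_neg (by omega), mul_zero]

lemma exists_arnoldiT_eq_add_vecMulVec (A : Matrix (Fin n) (Fin n) ℝ)
    (v : EuclideanSpace ℝ (Fin n)) (γ : ℝ) (k : ℕ) :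
    ∃ g : Fin k → ℝ, arnoldiT A v γ k = arnoldiH A v k + Matrix.vecMulVec g (eLast k) := by
  refine ⟨(γ * arnoldiSub A v (k - 1) ^ 2) • (((1 + γ • arnoldiH A v k)ᴴ)⁻¹ *ᵥ eLast k), ?_⟩
  rw [arnoldiT, Matrix.mul_vecMulVec, Matrix.smul_vecMulVec]

/-- The harmonic correction of `H_k` has the form `g e_kᵀ`, so it merges with the rank-one
remainder: `u = h_{k+1,k} v_{k+1} - V_k g`. -/
lemma exists_mul_arnoldiV_eq (A : Matrix (Fin n) (Fin n) ℝ) (v : EuclideanSpace ℝ (Fin n))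
    (γ : ℝ) (m : ℕ) :
    ∃ u : Fin n → ℝ, A * arnoldiV A v (m + 1) =
      arnoldiV A v (m + 1) * arnoldiT A v γ (m + 1) + Matrix.vecMulVec u (eLast (m + 1)) := by
  obtain ⟨g, hg⟩ := exists_arnoldiT_eq_add_vecMulVec A v γ (m + 1)
  refine ⟨arnoldiSub A v m • (arnoldiVec A v (m + 1)).ofLp - arnoldiV A v (m + 1) *ᵥ g, ?_⟩
  rw [mul_arnoldiV, hg, Matrix.mul_add, Matrix.mul_vecMulVec, Matrix.sub_vecMulVec]
  abel

lemma arnoldiV_mulVec_eFirst (A : Matrix (Fin n) (Fin n) ℝ) (v : EuclideanSpace ℝ (Fin n))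
    (hv : v ≠ 0) (m : ℕ) :
    arnoldiV A v (m + 1) *ᵥ (‖v‖ • eFirst (m + 1)) = v.ofLp := by
  have he : eFirst (m + 1) = Pi.single 0 1 := by
    ext i
    simp [eFirst, Pi.single_apply]
  have h0 : ‖v‖ ≠ 0 := norm_ne_zero_iff.2 hv
  ext p
  rw [he, Matrix.mulVec_smul, Matrix.mulVec_single_one]
  simp [arnoldiV, arnoldiVec_zero, h0]

lemma approx_eq (A : Matrix (Fin n) (Fin n) ℝ) (v : EuclideanSpace ℝ (Fin n)) (γ : ℝ) (ℓ k : ℕ)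
    (t : ℝ) : approx A v γ ℓ k t = WithLp.toLp 2
      (arnoldiV A v k *ᵥ (phi ℓ (-t • arnoldiT A v γ k) *ᵥ (‖v‖ • eFirst k))) := by
  ext p
  simp only [approx, Matrix.mulVec, dotProduct, arnoldiV, Matrix.of_apply, WithLp.ofLp_sum,
    Finset.sum_apply, PiLp.smul_apply, smul_eq_mul]
  exact Finset.sum_congr rfl fun j _ => mul_comm _ _

/-- Cramer's rule for the last component of the solution of `(z + T_k) x = c e_1`. -/
lemma det_mul_last_eq (A : Matrix (Fin n) (Fin n) ℝ) (v : EuclideanSpace ℝ (Fin n)) (γ : ℝ)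
    (m : ℕ) (z c : ℂ) (x : Fin (m + 1) → ℂ)
    (hx : (z • (1 : Matrix (Fin (m + 1)) (Fin (m + 1)) ℂ) + toC (arnoldiT A v γ (m + 1))) *ᵥ x =
      Pi.single 0 c) :
    (z • (1 : Matrix (Fin (m + 1)) (Fin (m + 1)) ℂ) + toC (arnoldiT A v γ (m + 1))).det *
        x (Fin.last m) =
      c * ((-1) ^ m * ((∏ j ∈ Finset.range m, arnoldiSub A v j : ℝ) : ℂ)) := by
  obtain ⟨g, hg⟩ := exists_arnoldiT_eq_add_vecMulVec A v γ (m + 1)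
  set N := z • (1 : Matrix (Fin (m + 1)) (Fin (m + 1)) ℂ) + toC (arnoldiT A v γ (m + 1)) with hN
  -- Deleting the first row and the last column removes the correction `g e_kᵀ` and leaves an upper
  -- triangular matrix with the subdiagonal coefficients on its diagonal; the shift `z` lies
  -- strictly above that diagonal.
  have hentry : ∀ i j : Fin m, j ≤ i → N i.succ j.castSucc =
      if i = j then (arnoldiSub A v j : ℂ) else 0 := by
    intro i j hij
    have h1 : i.succ ≠ j.castSucc := by
      intro h
      have := congrArg Fin.val h
      simp at this
      omega
    have hij' : (j : ℕ) ≤ i := hij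
    have hjm := j.2
    rw [hN, hg]
    simp only [toC, Matrix.add_apply, Matrix.smul_apply, Matrix.one_apply_ne h1, Matrix.map_apply,
      arnoldiH, Matrix.of_apply, Matrix.vecMulVec_apply, eLast, Fin.val_succ, Fin.val_castSucc,
      smul_zero, zero_add]
    rw [if_neg (show ¬ ((i : ℕ) + 1 ≤ j) by omega), if_neg (show ¬ ((j : ℕ) + 1 = m + 1) by omega),
      mul_zero, add_zero]
    by_cases h : i = j
    · simp [h]
    · rw [if_neg h, if_neg, Complex.ofReal_zero]
      intro h2
      exact h (Fin.ext (by omega))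
  have hadj : N.adjugate (Fin.last m) 0 =
      (-1) ^ m * ((∏ j ∈ Finset.range m, arnoldiSub A v j : ℝ) : ℂ) := by
    rw [Matrix.adjugate_fin_succ_eq_det_submatrix, Fin.succAbove_zero, Fin.succAbove_last,
      Matrix.det_of_isUpperTriangular, Complex.ofReal_prod,
      ← Fin.prod_univ_eq_prod_range (fun j => (arnoldiSub A v j : ℂ))]
    · congr 1
      · simp
      · refine Finset.prod_congr rfl fun i _ => ?_
        rw [Matrix.submatrix_apply, hentry i i le_rfl, if_pos rfl]
    · intro i j hij
      have hij' : j < i := hij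
      rw [Matrix.submatrix_apply, hentry i j hij'.le, if_neg hij'.ne']
  -- Multiplying by the adjugate instead of the inverse avoids any nonsingularity condition on `z +
  -- T`.
  have h := congrArg (fun w => (N.adjugate *ᵥ w) (Fin.last m)) hx
  simp only [Matrix.mulVec_mulVec, Matrix.adjugate_mul, Matrix.smul_mulVec, Matrix.one_mulVec,
    Pi.smul_apply, smul_eq_mul, Matrix.mulVec_single] at h
  rw [h, ← hadj]
  simp [mul_comm]

end ArnoldiRelations


/-! ### Differential equation and Laplace transform of the scaled error; formula for the residual -/

section ErrorEquation

open MeasureTheory Filter Asymptotics Set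

variable {n k : ℕ}

lemma isBigO_cvec (f : ℝ → Fin k → ℝ) : (fun s => cvec (f s)) =O[atTop] f :=
  (cvec (ι := Fin k)).isBigO_comp f atTop

lemma hasDerivAt_scaledPhi_mulVec (ℓ : ℕ) (M : Matrix (Fin k) (Fin k) ℝ) (b : Fin k → ℝ) (s : ℝ) :
    HasDerivAt (fun s => scaledPhi ℓ M s *ᵥ b)
      (forcing ℓ s • b - M *ᵥ (scaledPhi ℓ M s *ᵥ b)) s := by
  refine hasDerivAt_pi.2 fun i => ?_
  refine (HasDerivAt.fun_sum (u := Finset.univ) fun j _ =>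
    (hasDerivAt_scaledPhi_apply ℓ M i j s).mul_const (b j)).congr_deriv ?_
  rw [Matrix.mulVec_mulVec]
  simp [Matrix.mulVec, dotProduct, sub_mul, Matrix.one_apply, neg_add_eq_sub]

/-- The entries of `φ_ℓ(-s M)` are bounded by `1` for `s ≥ 0`, so only the factor `s ^ ℓ` grows. -/
lemma polyGrowth_scaledPhi_mulVec {M : Matrix (Fin k) (Fin k) ℝ}
    (hM : ∀ x : Fin k → ℝ, 0 ≤ x ⬝ᵥ (M *ᵥ x)) (ℓ : ℕ) (b : Fin k → ℝ) :
    (fun s => scaledPhi ℓ M s *ᵥ b) =O[atTop] fun s : ℝ => s ^ ℓ := by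
  refine isBigO_pi.2 fun i => ?_
  suffices h : ∀ j, (fun s => scaledPhi ℓ M s i j * b j) =O[atTop] fun s : ℝ => s ^ ℓ from
    IsBigO.fun_sum (s := Finset.univ) fun j _ => h j
  intro j
  refine IsBigO.of_bound |b j| ((eventually_ge_atTop 0).mono fun s hs => ?_)
  rw [scaledPhi, Matrix.smul_apply, smul_eq_mul, norm_mul, norm_mul, mul_comm, Real.norm_eq_abs,
    Real.norm_eq_abs (phi _ _ _ _)]
  exact mul_le_mul_of_nonneg_left
    (mul_le_of_le_one_right (norm_nonneg _) (abs_phi_neg_smul_apply_le hM ℓ hs i j)) (abs_nonneg _)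

lemma hasDerivAt_forcing_succ (ℓ : ℕ) (s : ℝ) :
    HasDerivAt (forcing (ℓ + 1)) (forcing ℓ s) s := by
  have h : forcing (ℓ + 1) = fun s : ℝ => s ^ ℓ / (ℓ ! : ℝ) := rfl
  rw [h]
  refine ((hasDerivAt_pow ℓ s).div_const _).congr_deriv ?_
  cases ℓ with
  | zero => simp [forcing]
  | succ ℓ =>
    simp only [forcing, Nat.factorial_succ, Nat.add_sub_cancel]
    push_cast
    field_simp

lemma continuous_forcing (ℓ : ℕ) : Continuous (forcing ℓ) := by
  cases ℓ with
  | zero => exact continuous_const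
  | succ ℓ => exact continuous_iff_continuousAt.2 fun s => (hasDerivAt_forcing_succ ℓ s).continuousAt

lemma isBigO_forcing (ℓ : ℕ) : forcing ℓ =O[atTop] fun s : ℝ => s ^ (ℓ - 1) := by
  cases ℓ with
  | zero => exact isBigO_zero _ _
  | succ ℓ =>
    refine IsBigO.of_bound (ℓ ! : ℝ)⁻¹ (Eventually.of_forall fun s => ?_)
    rw [forcing, norm_div, div_eq_inv_mul, Nat.add_sub_cancel]
    simp

/-- Induction through `forcing (ℓ + 1)' = forcing ℓ`: each integration divides the transform by `z`.
The conditional term is the initial value of `s ^ ℓ φ_ℓ(-s M)`, so that `ℓ = 0` (initial value, no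
forcing) and `ℓ ≥ 1` (forcing, zero initial value) give one formula. -/
lemma ite_add_laplace_forcing (ℓ : ℕ) {z : ℂ} (hz : 0 < z.re) :
    (if ℓ = 0 then 1 else 0) + laplace (fun s => (forcing ℓ s : ℂ)) z = (z ^ ℓ)⁻¹ := by
  have hz0 : z ≠ 0 := by rintro rfl; simp at hz
  have hg : ∀ ℓ, PolyGrowth fun s => (forcing ℓ s : ℂ) := fun ℓ =>
    ⟨ℓ - 1, (Complex.ofRealCLM.isBigO_comp (forcing ℓ) atTop).trans (isBigO_forcing ℓ)⟩
  induction ℓ with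
  | zero => simp [forcing, laplace]
  | succ ℓ ih =>
    have h := laplace_of_hasDerivAt (y := fun s => (forcing (ℓ + 1) s : ℂ))
      (f := fun s => (forcing ℓ s : ℂ)) (0 : ℂ →L[ℂ] ℂ)
      (fun s => by simpa using (hasDerivAt_forcing_succ ℓ s).ofReal_comp)
      (Complex.continuous_ofReal.comp (continuous_forcing ℓ)) (hg _) (hg _) hz
    have h0 : ((forcing (ℓ + 1) 0 : ℝ) : ℂ) = if ℓ = 0 then 1 else 0 := by
      cases ℓ <;> simp [forcing]
    rw [h0, ih, zero_apply, add_zero, smul_eq_mul] at h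
    rw [if_neg (Nat.succ_ne_zero ℓ), zero_add, pow_succ, mul_inv, ← h]
    field_simp

lemma laplace_ofReal_smul {E : Type*} [NormedAddCommGroup E] [NormedSpace ℂ E] [CompleteSpace E]
    (f : ℝ → ℂ) (c : E) (z : ℂ) : laplace (fun s => f s • c) z = laplace f z • c := by
  simp only [laplace, ← smul_assoc]
  exact integral_smul_const _ _

/-- The complex-linear operator on Euclidean space given by a real matrix. -/
def cop (M : Matrix (Fin k) (Fin k) ℝ) :
    EuclideanSpace ℂ (Fin k) →L[ℂ] EuclideanSpace ℂ (Fin k) :=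
  LinearMap.toContinuousLinearMap (Matrix.toEuclideanLin (toC M))

lemma cop_apply (M : Matrix (Fin k) (Fin k) ℝ) (x : EuclideanSpace ℂ (Fin k)) :
    cop M x = Matrix.toEuclideanLin (toC M) x := rfl

lemma laplace_scaledPhi {M : Matrix (Fin k) (Fin k) ℝ}
    (hM : ∀ x : Fin k → ℝ, 0 ≤ x ⬝ᵥ (M *ᵥ x)) (ℓ : ℕ) (b : Fin k → ℝ) {z : ℂ} (hz : 0 < z.re) :
    z • laplace (fun s => cvec (scaledPhi ℓ M s *ᵥ b)) z +
      cop M (laplace (fun s => cvec (scaledPhi ℓ M s *ᵥ b)) z) = (z ^ ℓ)⁻¹ • cvec b := by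
  have hf : ∀ s, cvec (forcing ℓ s • b) = (forcing ℓ s : ℂ) • cvec b := fun s => by
    ext i; simp [cvec_apply]
  have h := laplace_of_hasDerivAt (y := fun s => cvec (scaledPhi ℓ M s *ᵥ b))
    (f := fun s => (forcing ℓ s : ℂ) • cvec b) (cop M)
    (fun s => by
      have := (cvec (ι := Fin k)).hasFDerivAt.comp_hasDerivAt s
        (hasDerivAt_scaledPhi_mulVec ℓ M b s)
      refine this.congr_deriv ?_
      rw [map_sub, hf, cop_apply, toEuclideanLin_toC_cvec])
    (by have := continuous_forcing ℓ; fun_prop)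
    ⟨ℓ, (isBigO_cvec _).trans (polyGrowth_scaledPhi_mulVec hM ℓ b)⟩
    ⟨ℓ - 1, by
      simp only [← hf]
      refine (isBigO_cvec _).trans ?_
      refine IsBigO.trans (IsBigO.of_bound ‖b‖ (Eventually.of_forall fun s => ?_))
        (isBigO_forcing ℓ)
      rw [norm_smul, mul_comm]⟩ hz
  rw [h, laplace_ofReal_smul, ← ite_add_laplace_forcing ℓ hz, add_smul, scaledPhi_zero_right]
  congr 1
  split_ifs <;> simp

/-- The function `s ^ ℓ ê_{ℓ,k}(s)`. -/
def scaledErr (A : Matrix (Fin n) (Fin n) ℝ) (v : EuclideanSpace ℝ (Fin n)) (γ : ℝ) (ℓ k : ℕ)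
    (s : ℝ) : Fin n → ℝ :=
  scaledPhi ℓ A s *ᵥ v.ofLp -
    arnoldiV A v k *ᵥ (scaledPhi ℓ (arnoldiT A v γ k) s *ᵥ (‖v‖ • eFirst k))

lemma pow_smul_err (A : Matrix (Fin n) (Fin n) ℝ) (v : EuclideanSpace ℝ (Fin n)) (γ : ℝ)
    (ℓ k : ℕ) (s : ℝ) :
    s ^ ℓ • err A v γ ℓ k s = WithLp.toLp 2 (scaledErr A v γ ℓ k s) := by
  rw [err, approx_eq, scaledErr, scaledPhi, scaledPhi, smul_sub, Matrix.smul_mulVec,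
    Matrix.smul_mulVec, Matrix.mulVec_smul (arnoldiV A v k)]
  simp [Matrix.toEuclideanLin, Matrix.toLpLin_apply]

lemma mulVec_arnoldiV {A : Matrix (Fin n) (Fin n) ℝ} {v : EuclideanSpace ℝ (Fin n)} {γ : ℝ}
    {u : Fin n → ℝ}
    (hu : A * arnoldiV A v k = arnoldiV A v k * arnoldiT A v γ k + Matrix.vecMulVec u (eLast k))
    (x : Fin k → ℝ) : A *ᵥ (arnoldiV A v k *ᵥ x) =
      arnoldiV A v k *ᵥ (arnoldiT A v γ k *ᵥ x) + (eLast k ⬝ᵥ x) • u := by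
  rw [Matrix.mulVec_mulVec, hu, Matrix.add_mulVec, Matrix.mulVec_mulVec, Matrix.vecMulVec_mulVec]
  simp

/-- Both terms of the error carry the same forcing `forcing ℓ s • v`, because `V_k β e_1 = v`. It
cancels, and only the rank-one defect of the Arnoldi relation drives the error. -/
lemma hasDerivAt_scaledErr {A : Matrix (Fin n) (Fin n) ℝ} {v : EuclideanSpace ℝ (Fin n)} {γ : ℝ}
    {u : Fin n → ℝ}
    (hu : A * arnoldiV A v k = arnoldiV A v k * arnoldiT A v γ k + Matrix.vecMulVec u (eLast k))
    (hv : arnoldiV A v k *ᵥ (‖v‖ • eFirst k) = v.ofLp) (ℓ : ℕ) (s : ℝ) :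
    HasDerivAt (scaledErr A v γ ℓ k)
      ((-(eLast k ⬝ᵥ (scaledPhi ℓ (arnoldiT A v γ k) s *ᵥ (‖v‖ • eFirst k)))) • u -
        A *ᵥ scaledErr A v γ ℓ k s) s := by
  have h1 := hasDerivAt_scaledPhi_mulVec ℓ A v.ofLp s
  have h2 := (LinearMap.toContinuousLinearMap (arnoldiV A v k).mulVecLin).hasFDerivAt.comp_hasDerivAt
    s (hasDerivAt_scaledPhi_mulVec ℓ (arnoldiT A v γ k) (‖v‖ • eFirst k) s)
  refine (h1.sub h2).congr_deriv ?_
  simp only [LinearMap.coe_toContinuousLinearMap', Matrix.mulVecLin_apply, Matrix.mulVec_sub,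
    scaledErr, mulVec_arnoldiV hu, Matrix.mulVec_smul (arnoldiV A v k) (forcing ℓ s), hv, neg_smul]
  abel

/-- The residual is the defect of `ŷ` in the differential equation of `φ_ℓ(-t A) v`. Since `ŷ`
solves the equation projected to `T_k`, what remains is the Arnoldi defect `u` times the last
coordinate. -/
lemma resid_eq {A : Matrix (Fin n) (Fin n) ℝ} {v : EuclideanSpace ℝ (Fin n)} {γ : ℝ}
    {u : Fin n → ℝ}
    (hu : A * arnoldiV A v k = arnoldiV A v k * arnoldiT A v γ k + Matrix.vecMulVec u (eLast k))
    (hv : arnoldiV A v k *ᵥ (‖v‖ • eFirst k) = v.ofLp) (ℓ : ℕ) {t : ℝ} (ht : 0 < t) :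
    resid A v γ ℓ k t = -(corner A v γ ℓ k t * ‖v‖) • WithLp.toLp 2 u := by
  set T := arnoldiT A v γ k with hT
  set V := arnoldiV A v k with hV
  obtain ⟨b, hb⟩ : ∃ b, b = ‖v‖ • eFirst k := ⟨_, rfl⟩
  rw [← hb] at hv
  set W : (Fin k → ℝ) →L[ℝ] EuclideanSpace ℝ (Fin n) := LinearMap.toContinuousLinearMap
    ((WithLp.linearEquiv 2 ℝ (Fin n → ℝ)).symm.toLinearMap ∘ₗ V.mulVecLin) with hW
  have hWa : ∀ x, W x = WithLp.toLp 2 (V *ᵥ x) := fun x => rfl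
  set x := phi ℓ (-t • T) *ᵥ b with hx
  have happ : ∀ s : ℝ, approx A v γ ℓ k s = W (phi ℓ (-s • T) *ᵥ b) := fun s => by
    rw [approx_eq, hWa, hb]
  have hder : deriv (approx A v γ ℓ k) t =
      W ((forcing ℓ t / t ^ ℓ) • b - T *ᵥ x - ((ℓ : ℝ) / t) • x) := by
    -- Near `t ≠ 0` the factor `s ^ ℓ` can be divided out, so the derivative follows from the
    -- equation of `scaledPhi`; the quotient rule yields the term `-(ℓ / t) ŷ`.
    have h1 : approx A v γ ℓ k =ᶠ[nhds t] fun s => W ((s ^ ℓ)⁻¹ • (scaledPhi ℓ T s *ᵥ b)) := by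
      filter_upwards [eventually_ne_nhds ht.ne'] with s hs
      rw [happ, scaledPhi, Matrix.smul_mulVec, inv_smul_smul₀ (pow_ne_zero _ hs)]
    rw [h1.deriv_eq]
    have h2 := W.hasFDerivAt.comp_hasDerivAt t
      (((hasDerivAt_pow ℓ t).inv (pow_ne_zero _ ht.ne')).smul (hasDerivAt_scaledPhi_mulVec ℓ T b t))
    refine h2.deriv.trans ?_
    have h3 : scaledPhi ℓ T t *ᵥ b = t ^ ℓ • x := by rw [scaledPhi, Matrix.smul_mulVec]
    have h4 : (ℓ : ℝ) * t ^ (ℓ - 1) * t = ℓ * t ^ ℓ := by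
      cases ℓ with
      | zero => simp
      | succ ℓ => rw [Nat.add_sub_cancel, pow_succ]; ring
    congr 1
    rw [h3, Matrix.mulVec_smul, smul_sub, smul_smul, smul_smul, smul_smul, Pi.inv_apply,
      inv_mul_cancel₀ (pow_ne_zero _ ht.ne'), one_smul, ← div_eq_inv_mul]
    have h5 : -(↑ℓ * t ^ (ℓ - 1)) / (t ^ ℓ) ^ 2 * t ^ ℓ = -((ℓ : ℝ) / t) := by
      field_simp
      linarith
    rw [h5, neg_smul]
    abel
  have hA : Matrix.toEuclideanLin A (W x) =
      W (T *ᵥ x) + (eLast k ⬝ᵥ x) • WithLp.toLp 2 u := by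
    rw [hWa, hWa, Matrix.toEuclideanLin, Matrix.toLpLin_apply]
    change WithLp.toLp 2 (A *ᵥ (V *ᵥ x)) = _
    rw [hV, mulVec_arnoldiV hu]
    rfl
  have hc : eLast k ⬝ᵥ x = corner A v γ ℓ k t * ‖v‖ := by
    rw [hx, hb, corner, Matrix.mulVec_smul, dotProduct_smul, smul_eq_mul, mul_comm]
  have hWb : W b = v := by rw [hWa, hv]
  cases ℓ with
  | zero =>
    rw [resid, hder, happ, ← hx, hA, hc]
    simp [forcing]
  | succ ℓ =>
    rw [resid, hder, happ, ← hx, hA, hc, map_sub, map_sub, map_smul, map_smul, hWb]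
    have h6 : forcing (ℓ + 1) t / t ^ (ℓ + 1) = 1 / (t * (ℓ ! : ℝ)) := by
      rw [forcing]
      field_simp
      ring
    rw [h6, neg_smul]
    abel

lemma scaledErr_zero {A : Matrix (Fin n) (Fin n) ℝ} {v : EuclideanSpace ℝ (Fin n)} {γ : ℝ}
    (hv : arnoldiV A v k *ᵥ (‖v‖ • eFirst k) = v.ofLp) (ℓ : ℕ) : scaledErr A v γ ℓ k 0 = 0 := by
  rw [scaledErr, scaledPhi_zero_right, scaledPhi_zero_right]
  split_ifs
  · rw [Matrix.one_mulVec, Matrix.one_mulVec, hv, sub_self]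
  · simp

lemma laplace_scaledErr {A : Matrix (Fin n) (Fin n) ℝ} {v : EuclideanSpace ℝ (Fin n)} {γ : ℝ}
    {m : ℕ} {u : Fin n → ℝ}
    (hu : A * arnoldiV A v (m + 1) =
      arnoldiV A v (m + 1) * arnoldiT A v γ (m + 1) + Matrix.vecMulVec u (eLast (m + 1)))
    (hv : arnoldiV A v (m + 1) *ᵥ (‖v‖ • eFirst (m + 1)) = v.ofLp)
    (hA : ∀ x : Fin n → ℝ, 0 ≤ x ⬝ᵥ (A *ᵥ x))
    (hT : ∀ x : Fin (m + 1) → ℝ, 0 ≤ x ⬝ᵥ (arnoldiT A v γ (m + 1) *ᵥ x))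
    (ℓ : ℕ) {z : ℂ} (hz : 0 < z.re) :
    PolyGrowth (fun s => cvec (scaledErr A v γ ℓ (m + 1) s)) ∧
    z • laplace (fun s => cvec (scaledErr A v γ ℓ (m + 1) s)) z +
      cop A (laplace (fun s => cvec (scaledErr A v γ ℓ (m + 1) s)) z) =
      -(laplace (fun s => cvec (scaledPhi ℓ (arnoldiT A v γ (m + 1)) s *ᵥ
        (‖v‖ • eFirst (m + 1)))) z (Fin.last m)) • cvec u := by
  set T := arnoldiT A v γ (m + 1) with hTdef
  set b := ‖v‖ • eFirst (m + 1) with hb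
  have hlast : ∀ x : Fin (m + 1) → ℝ, eLast (m + 1) ⬝ᵥ x = x (Fin.last m) := fun x => by
    have : eLast (m + 1) = Pi.single (Fin.last m) 1 := by
      ext i
      simp [eLast, Pi.single_apply, Fin.ext_iff]
    simp [this]
  have hPg := polyGrowth_scaledPhi_mulVec hT ℓ b
  have hPc : Continuous fun s => scaledPhi ℓ T s *ᵥ b :=
    continuous_iff_continuousAt.2 fun s => (hasDerivAt_scaledPhi_mulVec ℓ T b s).continuousAt
  have hcg : PolyGrowth fun s => cvec (scaledPhi ℓ T s *ᵥ b) :=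
    ⟨ℓ, (isBigO_cvec _).trans hPg⟩
  have hgrowth : PolyGrowth (fun s => cvec (scaledErr A v γ ℓ (m + 1) s)) := by
    refine ⟨ℓ, (isBigO_cvec _).trans ?_⟩
    refine (polyGrowth_scaledPhi_mulVec hA ℓ v.ofLp).sub ?_
    exact ((LinearMap.toContinuousLinearMap (arnoldiV A v (m + 1)).mulVecLin).isBigO_comp
      (fun s => scaledPhi ℓ T s *ᵥ b) atTop).trans hPg
  refine ⟨hgrowth, ?_⟩
  have hfeq : ∀ s, cvec ((-(eLast (m + 1) ⬝ᵥ (scaledPhi ℓ T s *ᵥ b))) • u) =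
      (-(cvec (scaledPhi ℓ T s *ᵥ b) (Fin.last m))) • cvec u := fun s => by
    ext i
    simp [cvec_apply, hlast]
  have hproj : laplace (fun s => -(cvec (scaledPhi ℓ T s *ᵥ b) (Fin.last m))) z =
      -(laplace (fun s => cvec (scaledPhi ℓ T s *ᵥ b)) z (Fin.last m)) := by
    have h := (-(EuclideanSpace.proj (𝕜 := ℂ) (Fin.last m) :
      EuclideanSpace ℂ (Fin (m + 1)) →L[ℂ] ℂ)).integral_comp_comm
        (hcg.integrableOn (by fun_prop) hz)
    refine Eq.trans ?_ h
    rw [laplace]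
    simp
  have h := laplace_of_hasDerivAt (y := fun s => cvec (scaledErr A v γ ℓ (m + 1) s))
    (f := fun s => (-(cvec (scaledPhi ℓ T s *ᵥ b) (Fin.last m))) • cvec u) (cop A)
    (fun s => by
      refine ((cvec (ι := Fin n)).hasFDerivAt.comp_hasDerivAt s
        (hasDerivAt_scaledErr hu hv ℓ s)).congr_deriv ?_
      rw [map_sub, hfeq, cop_apply, toEuclideanLin_toC_cvec])
    (by fun_prop) hgrowth
    ⟨ℓ, by
      simp only [← hfeq]
      refine (isBigO_cvec _).trans ?_
      refine IsBigO.trans (IsBigO.of_bound ‖u‖ (Eventually.of_forall fun s => ?_)) hPg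
      rw [norm_smul, mul_comm, norm_neg, hlast]
      exact mul_le_mul_of_nonneg_left (norm_le_pi_norm _ _) (norm_nonneg _)⟩ hz
  rw [h, scaledErr_zero hv, map_zero, zero_add, laplace_ofReal_smul, hproj]

end ErrorEquation


/-! ### Estimates on the line `Re z = ε` and the final bound -/

section ErrorBound

open MeasureTheory Set

variable {n k : ℕ}

lemma norm_inv_pow_vertical_line {ε : ℝ} (hε : 0 < ε) (ℓ : ℕ) (ρ : ℝ) :
    ‖((ε + ρ * Complex.I : ℂ) ^ ℓ)⁻¹‖ = (ε ^ ℓ)⁻¹ * (1 + ρ ^ 2 / ε ^ 2) ^ (-(ℓ : ℝ) / 2) := by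
  have hb : 0 < 1 + ρ ^ 2 / ε ^ 2 := by positivity
  have h1 : ‖(ε + ρ * Complex.I : ℂ)‖ = ε * (1 + ρ ^ 2 / ε ^ 2) ^ ((1 : ℝ) / 2) := by
    rw [Complex.norm_add_mul_I, ← Real.sqrt_eq_rpow]
    nth_rw 2 [← Real.sqrt_sq hε.le]
    rw [← Real.sqrt_mul (sq_nonneg ε)]
    congr 1
    field_simp
  rw [norm_inv, norm_pow, h1, mul_pow, mul_inv, ← Real.rpow_mul_natCast hb.le, ← Real.rpow_neg hb.le]
  congr 2
  ring

lemma re_vertical_line (ε ρ : ℝ) : (ε + ρ * Complex.I : ℂ).re = ε := by simp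

/-- Cramer's rule gives this component exactly, up to sign, as `β z^(-ℓ) ∏ h_{j+1,j} / det(z + T)`;
the inequality comes only from the lower bound for the determinant. -/
lemma norm_laplace_last_le {A : Matrix (Fin n) (Fin n) ℝ} {v : EuclideanSpace ℝ (Fin n)} {γ : ℝ}
    {m : ℕ} (hT : ∀ x : Fin (m + 1) → ℝ, 0 ≤ x ⬝ᵥ (arnoldiT A v γ (m + 1) *ᵥ x))
    {ε : ℝ} (hε : 0 < ε) (hE : ∀ μ ∈ eigs (arnoldiT A v γ (m + 1)), 0 < ε + μ.re) (ℓ : ℕ) (ρ : ℝ) :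
    ‖laplace (fun s => cvec (scaledPhi ℓ (arnoldiT A v γ (m + 1)) s *ᵥ
        (‖v‖ • eFirst (m + 1)))) (ε + ρ * Complex.I) (Fin.last m)‖ ≤
      ‖v‖ * (∏ j ∈ Finset.range m, arnoldiSub A v j) /
        (ε ^ ℓ * omega (arnoldiT A v γ (m + 1)) ε) * integrand (arnoldiT A v γ (m + 1)) ℓ ε ρ := by
  set T := arnoldiT A v γ (m + 1) with hTd
  set z : ℂ := ε + ρ * Complex.I with hz
  have hzre : 0 < z.re := by rw [hz, re_vertical_line]; exact hε
  have h := laplace_scaledPhi hT ℓ (‖v‖ • eFirst (m + 1)) hzre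
  set Y := laplace (fun s => cvec (scaledPhi ℓ T s *ᵥ (‖v‖ • eFirst (m + 1)))) z
  have hx : (z • (1 : Matrix (Fin (m + 1)) (Fin (m + 1)) ℂ) + toC T) *ᵥ Y.ofLp =
      Pi.single 0 ((z ^ ℓ)⁻¹ * ‖v‖) := by
    have h2 := congrArg WithLp.ofLp h
    rw [Matrix.add_mulVec, Matrix.smul_mulVec, Matrix.one_mulVec]
    refine Eq.trans ?_ (h2.trans ?_)
    · rfl
    · ext i
      by_cases hi : i = 0
      · subst hi
        simp [cvec_apply, eFirst]
      · simp [cvec_apply, eFirst, hi]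
  have hdet := congrArg norm (det_mul_last_eq A v γ m z _ Y.ofLp hx)
  have hprod : 0 ≤ ∏ j ∈ Finset.range m, arnoldiSub A v j :=
    Finset.prod_nonneg fun j _ => norm_nonneg _
  rw [norm_mul, norm_mul, norm_mul, norm_mul, norm_pow, norm_neg, norm_one, one_pow, one_mul,
    Complex.norm_real, Complex.norm_real, norm_norm, Real.norm_of_nonneg hprod,
    norm_inv_pow_vertical_line hε] at hdet
  have hle := omega_mul_varsig_le_norm_det ρ hE
  have ho := omega_pos hE
  have hs := varsig_pos T ε ρ
  have h3 : omega T ε * varsig T ε ρ * ‖Y (Fin.last m)‖ ≤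
      (ε ^ ℓ)⁻¹ * (1 + ρ ^ 2 / ε ^ 2) ^ (-(ℓ : ℝ) / 2) * ‖v‖ *
        ∏ j ∈ Finset.range m, arnoldiSub A v j := by
    rw [← hdet]
    exact mul_le_mul_of_nonneg_right hle (norm_nonneg _)
  rw [mul_comm, ← le_div_iff₀ (mul_pos ho hs)] at h3
  refine h3.trans (le_of_eq ?_)
  rw [integrand]
  field_simp

lemma norm_err_le {A : Matrix (Fin n) (Fin n) ℝ} {v : EuclideanSpace ℝ (Fin n)} {γ : ℝ}
    {ℓ m : ℕ} {t ε a ϑ : ℝ} (hv : v ≠ 0) (ht : 0 < t) (hε : 0 < ε) (ha : 0 ≤ a)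
    (hϑ : ϑ ≤ Real.pi / 2) (hWA : numRange (toC A) ⊆ sector ϑ a)
    (hWT : numRange (toC (arnoldiT A v γ (m + 1))) ⊆ sector ϑ a)
    (hcorner : corner A v γ ℓ (m + 1) t ≠ 0)
    (hint : Integrable (integrand (arnoldiT A v γ (m + 1)) ℓ ε)) :
    ‖err A v γ ℓ (m + 1) t‖ ≤ cHat A v γ ℓ (m + 1) t ε a *
      (∫ ρ in Ioi (0 : ℝ), integrand (arnoldiT A v γ (m + 1)) ℓ ε ρ) *
        ‖resid A v γ ℓ (m + 1) t‖ := by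
  have hA := dotProduct_mulVec_nonneg ha hϑ hWA
  have hT := dotProduct_mulVec_nonneg ha hϑ hWT
  have hE : ∀ μ ∈ eigs (arnoldiT A v γ (m + 1)), 0 < ε + μ.re := fun μ hμ => by
    have := le_re_of_mem_eigs hϑ hWT hμ
    linarith
  obtain ⟨u, hu⟩ := exists_mul_arnoldiV_eq A v γ m
  have hV := arnoldiV_mulVec_eFirst A v hv m
  set g : ℝ → EuclideanSpace ℂ (Fin n) := fun s => cvec (scaledErr A v γ ℓ (m + 1) s) with hg
  have hgc : Continuous g := by
    have : Continuous (scaledErr A v γ ℓ (m + 1)) :=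
      continuous_iff_continuousAt.2 fun s => (hasDerivAt_scaledErr hu hV ℓ s).continuousAt
    fun_prop
  have hg0 : g 0 = 0 := by
    rw [hg]
    dsimp only
    rw [scaledErr_zero hV, map_zero]
  set C := ‖v‖ * (∏ j ∈ Finset.range m, arnoldiSub A v j) /
    (ε ^ ℓ * omega (arnoldiT A v γ (m + 1)) ε) with hC
  set U := ‖(WithLp.toLp 2 u : EuclideanSpace ℝ (Fin n))‖ with hU
  have hbound : ∀ ρ : ℝ, ‖laplace g (ε + ρ * Complex.I)‖ ≤
      C * U / (ε + a) * integrand (arnoldiT A v γ (m + 1)) ℓ ε ρ := by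
    intro ρ
    have hz : 0 < (ε + ρ * Complex.I : ℂ).re := by rw [re_vertical_line]; exact hε
    have h1 := mul_norm_le_norm_resolvent hϑ hWA (ε + ρ * Complex.I) (laplace g (ε + ρ * Complex.I))
    rw [← cop_apply, (laplace_scaledErr hu hV hA hT ℓ hz).2, norm_smul, norm_neg, norm_cvec,
      re_vertical_line, mul_comm (ε + a), ← le_div_iff₀ (by positivity)] at h1
    refine h1.trans ?_
    rw [show C * U / (ε + a) * integrand (arnoldiT A v γ (m + 1)) ℓ ε ρ =
      C * integrand (arnoldiT A v γ (m + 1)) ℓ ε ρ * U / (ε + a) by ring]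
    gcongr
    exact norm_laplace_last_le hT hε hE ℓ ρ
  -- The growth statement does not involve `z`; the value `1` is an arbitrary point of the right
  -- half-plane.
  have hg1 : PolyGrowth g :=
    (laplace_scaledErr (z := 1) hu hV hA hT ℓ (by simp)).1
  have hmain := norm_le_of_norm_laplace_le hgc hg0 hg1 hε (hint.const_mul _) hbound ht
  -- The integrand depends on `ρ` only through `ρ²`; the resulting factor `2` turns `1/(2π)` into
  -- the `1/π` of `cHat`.
  have heven : ∫ ρ, integrand (arnoldiT A v γ (m + 1)) ℓ ε ρ =
      2 * ∫ ρ in Ioi (0 : ℝ), integrand (arnoldiT A v γ (m + 1)) ℓ ε ρ := by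
    rw [← integral_comp_abs]
    simp only [integrand_abs]
  rw [integral_const_mul, heven, hg, norm_cvec, ← pow_smul_err, norm_smul, norm_pow,
    Real.norm_of_nonneg ht.le, mul_comm, ← le_div_iff₀ (by positivity)] at hmain
  refine hmain.trans (le_of_eq ?_)
  have ho := omega_pos hE
  have hc : |corner A v γ ℓ (m + 1) t| ≠ 0 := abs_ne_zero.2 hcorner
  -- The factor `‖v‖ ‖u‖` of the bound is `‖r̂(t)‖` divided by the corner entry, which is where the
  -- nonvanishing of that entry enters.
  rw [resid_eq hu hV ℓ ht, norm_smul, norm_neg, norm_mul, norm_norm, Real.norm_eq_abs, ← hU, cHat, hC,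
    Nat.add_sub_cancel]
  have h2 : ε + a ≠ 0 := by positivity
  field_simp
  ring

end ErrorBound

end

end HarmonicArnoldi

theorem theorem4p5 {n : ℕ} (A : Matrix (Fin n) (Fin n) ℝ) (v : EuclideanSpace ℝ (Fin n))
    (k ℓ : ℕ) (γ t ε a ϑ : ℝ)
    (hk : 1 ≤ k) (hv : v ≠ 0)
    (hArnoldi : ∀ j < k, HarmonicArnoldi.arnoldiSub A v j ≠ 0)
    (hγ : IsUnit (1 + γ • HarmonicArnoldi.arnoldiH A v k))
    (ht : 0 < t) (hε : 0 < ε) (ha : 0 ≤ a) (hϑ₀ : 0 ≤ ϑ) (hϑ₁ : ϑ ≤ Real.pi / 2)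
    (hWA : HarmonicArnoldi.numRange (HarmonicArnoldi.toC A) ⊆ HarmonicArnoldi.sector ϑ a)
    (hWT : HarmonicArnoldi.numRange (HarmonicArnoldi.toC (HarmonicArnoldi.arnoldiT A v γ k)) ⊆
      HarmonicArnoldi.sector ϑ a)
    (hcorner : HarmonicArnoldi.corner A v γ ℓ k t ≠ 0)
    (hcount : 4 ≤ k +
      Multiset.card (HarmonicArnoldi.realEigs (HarmonicArnoldi.arnoldiT A v γ k)) + 2 * ℓ) :
    MeasureTheory.IntegrableOn
        (HarmonicArnoldi.integrand (HarmonicArnoldi.arnoldiT A v γ k) ℓ ε) (Set.Ioi 0) ∧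
      ‖HarmonicArnoldi.err A v γ ℓ k t‖ ≤
        HarmonicArnoldi.cHat A v γ ℓ k t ε a *
          (∫ ρ in Set.Ioi (0 : ℝ),
            HarmonicArnoldi.integrand (HarmonicArnoldi.arnoldiT A v γ k) ℓ ε ρ) *
          ‖HarmonicArnoldi.resid A v γ ℓ k t‖ := by
  have hint : MeasureTheory.Integrable
      (HarmonicArnoldi.integrand (HarmonicArnoldi.arnoldiT A v γ k) ℓ ε) :=
    HarmonicArnoldi.integrable_integrand hε (fun μ hμ => by
      have := HarmonicArnoldi.le_re_of_mem_eigs hϑ₁ hWT hμ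
      linarith) hcount
  obtain ⟨m, rfl⟩ := Nat.exists_eq_add_of_le' hk
  exact ⟨hint.integrableOn, HarmonicArnoldi.norm_err_le hv ht hε ha hϑ₁ hWA hWT hcorner hint⟩
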